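/- Fix $\beta,\lambda,c_a,c_f>0$, $0<p\le 1$ and $C_h\ge 0$. Consider the following semi-Markov decision problem for caching one content. The states are $(\tau,1,b)$ with $\tau\ge 0$, $b\in\{0,1\}$ (the content is cached, was last fetched $\tau$ time units ago, and is requested iff $b=1$) and $(0,b)$ (the content is not cached, and is requested iff $b=1$). The available actions are $0$ (keep, serving the copy if it is requested), $1$ (fetch, serve and cache), $2$ (discard, serving the copy first if it is requested) and $3$ (fetch, serve and discard): all four in $(\tau,1,1)$, the actions $0,2$ in $(\tau,1,0)$, the actions $1,3$ in $(0,1)$, and no choice in $(0,0)$. The times between consecutive epochs are i.i.d. exponential with rate $\beta$, and at each epoch the content is requested with probability $p$, independently of everything else. If $\Delta$ is the time to the next epoch and $b'$ the next request indicator, the next state is $(\tau+\Delta,1,b')$ after action $0$, $(\Delta,1,b')$ after action $1$, and $(0,b')$ otherwise. The stage costs are $$c((\tau,1,1),a)=c_a\lambda\tau\,1_{\{a\in\{0,2\}\}}+c_f1_{\{a\in\{1,3\}\}}+\tfrac{C_h}{\beta}1_{\{a\in\{0,1\}\}},\qquad c((\tau,1,0),a)=\tfrac{C_h}{\beta}1_{\{a=0\}},$$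 $$c((0,1),a)=c_f+\tfrac{C_h}{\beta}1_{\{a=1\}},\qquad c((0,0))=0 .$$ Admissible policies are sequences $(\mu_k)_{k\ge0}$ of measurable maps from states to available actions, with action $a_k=\mu_k(s_k)$ at epoch $k$. Let $A(T)$ be the number of epochs $t_1,t_2,\dots$ in $(0,T]$ (with $t_0=0$), and let the cost up to $T$ be $\sum_{k=1}^{A(T)}c(s_k,a_k)$. A stationary policy $\pi^*$ is called *optimal with cost $\theta$* if: (i) for every initial state, its expected cost up to $T$ divided by $T$ converges to $\theta$, and divided by $\mathbb E[A(T)]$ converges to $\theta/\beta$, as $T\to\infty$, while for every admissible policy and every initial state the corresponding lower limits are at least $\theta$ and $\theta/\beta$; (ii) there is a bounded measurable function $h$ with $h(s)=\min_a\{c(s,a)-\theta/\beta+\mathbb E[h(s')\mid s,a]\}$ for every state $s$, where $s'$ is the next state, and $\pi^*(s)$ attains this minimum for every $s$. Put $$\tau^0=\frac{c_f}{c_a\lambda},\qquad \tau^*=-\frac1{p\beta}+\sqrt{\Big(\frac1{p\beta}\Big)^2+\frac{2c_f}{p\beta c_a\lambda}},\qquad I=p\beta c_f-pc_a\lambda(1-e^{-\beta\tau^0}).$$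 **Theorem.** 1. If $C_h=0$, the policy $\pi^*(\tau,1,1)=0$ for $\tau\le\tau^*$ and $1$ for $\tau>\tau^*$, $\pi^*(\tau,1,0)=0$, $\pi^*(0,1)=1$ is optimal with cost $\theta=p\beta c_a\lambda\tau^*$. 2. If $0<C_h\le I$, the equations $$c_a\lambda p\beta\Big(\tilde\tau\bar\tau-\frac{\bar\tau^2}{2}\Big)-C_h\bar\tau+c_a\lambda\tilde\tau-c_f=0,\qquad \beta(\tilde\tau-\bar\tau)+e^{-\beta(\tilde\tau-\bar\tau)}-1-\frac{C_h}{pc_a\lambda}=0$$ have exactly one solution with $0\le\bar\tau\le\tilde\tau$, and it satisfies $0\le\bar\tau<\tau^*<\tilde\tau\le\tau^0$. If moreover $C_h<I$, the policy $\pi^*(\tau,1,1)=0$ for $\tau\le\bar\tau$, $2$ for $\bar\tau\le\tau\le\tilde\tau$ (at $\tau=\bar\tau$ either of $0$ and $2$ may be taken) and $1$ for $\tau>\tilde\tau$, $\pi^*(\tau,1,0)=0$ for $\tau\le\bar\tau$ and $2$ for $\tau>\bar\tau$, $\pi^*(0,1)=1$ is optimal with cost $\theta=p\beta c_a\lambda\tilde\tau$.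 3. If $C_h>I$, the policy $\pi^*(\tau,1,1)=2$ for $\tau\le\tau^0$ and $3$ for $\tau>\tau^0$, $\pi^*(\tau,1,0)=2$, $\pi^*(0,1)=3$ is optimal with cost $\theta=p\beta c_f$. -/

import Mathlib

open MeasureTheory ProbabilityTheory Filter Topology
open scoped NNReal ENNReal

/-- Parameters of the single-content caching problem: the rate `beta` of the request epochs, the
probability `p` that a request is for the content, the update rate `lam` of the content at the
server, the ageing cost `ca` per update, the fetching cost `cf`, and the holding cost `Ch` per unit
of time. -/
structure CachingModel where
  beta : ℝ
  p : ℝ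
  lam : ℝ
  ca : ℝ
  cf : ℝ
  Ch : ℝ
  beta_pos : 0 < beta
  p_pos : 0 < p
  p_le_one : p ≤ 1
  lam_pos : 0 < lam
  ca_pos : 0 < ca
  cf_pos : 0 < cf
  Ch_nonneg : 0 ≤ Ch

/-- States at a request epoch. `Sum.inl (τ, b)` is the state `(τ, 1, b)`: the content is cached and
was last fetched `τ` time units ago. `Sum.inr b` is the state `(0, b)`: the content is not cached.
In both cases `b` tells whether the current request is for the content. -/
abbrev CachingState : Type := (ℝ≥0 × Bool) ⊕ Bool

/-- Actions: `keep` is action 0 (keep the copy, serving it if it is requested), `fetchKeep` is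
action 1 (fetch, serve and cache), `discard` is action 2 (discard the copy, serving it first if it
is requested), `fetchDiscard` is action 3 (fetch, serve and discard); `idle` stands for the absence
of an action in the state `(0, 0)`. -/
inductive CachingAction : Type
  | keep
  | fetchKeep
  | discard
  | fetchDiscard
  | idle

instance : MeasurableSpace CachingAction := ⊤

/-- The actions that are available in a state. -/
def availableActions : CachingState → Set CachingAction
  | Sum.inl (_, true) => {.keep, .fetchKeep, .discard, .fetchDiscard}
  | Sum.inl (_, false) => {.keep, .discard}
  | Sum.inr true => {.fetchKeep, .fetchDiscard}
  | Sum.inr false => {.idle}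

/-- The next state, from the present state, the action, and the pair `(Δ, b')` of the time until the
next request epoch and the indicator that the next request is for the content. (On unavailable
actions the value is irrelevant.) -/
noncomputable def nextState : CachingState → CachingAction → ℝ × Bool → CachingState
  | Sum.inl (τ, _), .keep, w => Sum.inl (τ + w.1.toNNReal, w.2)
  | _, .fetchKeep, w => Sum.inl (w.1.toNNReal, w.2)
  | _, _, w => Sum.inr w.2

/-- A policy is a sequence of decision rules, one for each epoch: the action at epoch `k` is
`π k s` if the state at epoch `k` is `s`. It is admissible if the rules are measurable and choose
available actions only. -/
def IsAdmissiblePolicy (π : ℕ → CachingState → CachingAction) : Prop :=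
  ∀ k, Measurable (π k) ∧ ∀ s, π k s ∈ availableActions s

namespace CachingModel

variable (M : CachingModel)

/-- The expected single-stage cost `c(s, a)`. -/
noncomputable def stageCost : CachingState → CachingAction → ℝ
  | Sum.inl (τ, true), .keep => M.ca * M.lam * τ + M.Ch / M.beta
  | Sum.inl (_, true), .fetchKeep => M.cf + M.Ch / M.beta
  | Sum.inl (τ, true), .discard => M.ca * M.lam * τ
  | Sum.inl (_, true), .fetchDiscard => M.cf
  | Sum.inl (_, false), .keep => M.Ch / M.beta
  | Sum.inr true, .fetchKeep => M.cf + M.Ch / M.beta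
  | Sum.inr true, .fetchDiscard => M.cf
  | _, _ => 0

/-- The joint law of the time until the next request epoch, exponential with rate `beta`, and of the
independent Bernoulli(`p`) indicator that this request is for the content. -/
noncomputable def noise : Measure (ℝ × Bool) :=
  (expMeasure M.beta).prod
    (bernoulliMeasure true false ⟨M.p, M.p_pos.le, M.p_le_one⟩)

instance : IsProbabilityMeasure M.noise := by
  have := isProbabilityMeasure_expMeasure M.beta_pos
  unfold noise
  infer_instance

/-- The law of the whole driving sequence: independent copies of `noise`. The coordinate `ω k`
carries the time between the epochs `k` and `k + 1` and the indicator at epoch `k + 1`. -/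
noncomputable def law : Measure (ℕ → ℝ × Bool) :=
  Measure.infinitePi fun _ => M.noise

end CachingModel

/-- The `k`-th request epoch `t_k`, where `t_0 = 0`. -/
noncomputable def requestEpoch (ω : ℕ → ℝ × Bool) (k : ℕ) : ℝ :=
  ∑ i ∈ Finset.range k, (ω i).1

/-- The state `s_k` at the `k`-th epoch under the policy `π`, starting from `s_0 = s`. -/
noncomputable def stateAt (π : ℕ → CachingState → CachingAction) (s : CachingState)
    (ω : ℕ → ℝ × Bool) : ℕ → CachingState
  | 0 => s
  | k + 1 => nextState (stateAt π s ω k) (π k (stateAt π s ω k)) (ω k)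

open Classical in
/-- `A(T)`: the number of epochs `t_1, t_2, …` until time `T`. -/
noncomputable def epochCount (ω : ℕ → ℝ × Bool) (T : ℝ) : ℝ≥0∞ :=
  ∑' k : ℕ, if requestEpoch ω (k + 1) ≤ T then 1 else 0

namespace CachingModel

variable (M : CachingModel)

open Classical in
/-- The cost `∑_{k = 1}^{A(T)} c(s_k, a_k)` incurred until time `T`. -/
noncomputable def totalCost (π : ℕ → CachingState → CachingAction) (s : CachingState)
    (ω : ℕ → ℝ × Bool) (T : ℝ) : ℝ≥0∞ :=
  ∑' k : ℕ, if requestEpoch ω (k + 1) ≤ T then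
    ENNReal.ofReal (M.stageCost (stateAt π s ω (k + 1)) (π (k + 1) (stateAt π s ω (k + 1)))) else 0

/-- The expected cost per unit of time until time `T`. -/
noncomputable def timeAverageCost (π : ℕ → CachingState → CachingAction) (s : CachingState)
    (T : ℝ) : ℝ≥0∞ :=
  (∫⁻ ω, M.totalCost π s ω T ∂M.law) / ENNReal.ofReal T

/-- The expected cost until time `T`, divided by the expected number of epochs until time `T`. -/
noncomputable def epochAverageCost (π : ℕ → CachingState → CachingAction) (s : CachingState)
    (T : ℝ) : ℝ≥0∞ :=
  (∫⁻ ω, M.totalCost π s ω T ∂M.law) / ∫⁻ ω, epochCount ω T ∂M.law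

/-- The right-hand side of Bellman's equation in state `s` for the action `a`, with average cost `θ`
per unit of time and relative value function `h`. -/
noncomputable def bellmanValue (θ : ℝ) (h : CachingState → ℝ) (s : CachingState)
    (a : CachingAction) : ℝ :=
  M.stageCost s a - θ / M.beta + ∫ w, h (nextState s a w) ∂M.noise

/-- `f` is an optimal stationary policy and `θ` is the optimal cost per unit of time, whatever the
initial state is. This comprises optimality for the long-run average cost (per unit of time, and per
epoch) among all admissible policies, and optimality in every single state in the sense of Bellman's
equation: `f` picks a minimizing action for a bounded relative value function. -/
structure IsOptimal (f : CachingState → CachingAction) (θ : ℝ) : Prop where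
  admissible : IsAdmissiblePolicy fun _ => f
  tendsto_timeAverageCost : ∀ s,
    Tendsto (M.timeAverageCost (fun _ => f) s) atTop (𝓝 (ENNReal.ofReal θ))
  le_timeAverageCost : ∀ π, IsAdmissiblePolicy π → ∀ s,
    ENNReal.ofReal θ ≤ liminf (M.timeAverageCost π s) atTop
  tendsto_epochAverageCost : ∀ s,
    Tendsto (M.epochAverageCost (fun _ => f) s) atTop (𝓝 (ENNReal.ofReal (θ / M.beta)))
  le_epochAverageCost : ∀ π, IsAdmissiblePolicy π → ∀ s,
    ENNReal.ofReal (θ / M.beta) ≤ liminf (M.epochAverageCost π s) atTop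
  bellman : ∃ h : CachingState → ℝ, Measurable h ∧ (∃ B, ∀ s, |h s| ≤ B) ∧
    (∀ s, IsLeast (M.bellmanValue θ h s '' availableActions s) (h s)) ∧
    ∀ s, M.bellmanValue θ h s (f s) = h s

/-- `τ⁰ = c_f / (c_a λ)`. -/
noncomputable def tauZero : ℝ := M.cf / (M.ca * M.lam)

/-- `τ^* = -1/(pβ) + √((1/(pβ))² + 2 c_f/(pβ c_a λ))`. -/
noncomputable def tauStar : ℝ :=
  -(1 / (M.p * M.beta)) +
    √((1 / (M.p * M.beta)) ^ 2 + 2 * M.cf / (M.p * M.beta * M.ca * M.lam))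

/-- `I = pβ c_f - p c_a λ (1 - exp(-β τ⁰))`. -/
noncomputable def holdingThreshold : ℝ :=
  M.p * M.beta * M.cf - M.p * M.ca * M.lam * (1 - Real.exp (-M.beta * M.tauZero))

/-- The two equations for the thresholds `(τ̄, τ̃)`. -/
def ThresholdEquations (τbar τtil : ℝ) : Prop :=
  M.ca * M.lam * M.p * M.beta * (τtil * τbar - τbar ^ 2 / 2) - M.Ch * τbar
      + M.ca * M.lam * τtil - M.cf = 0 ∧
  M.beta * (τtil - τbar) + Real.exp (-M.beta * (τtil - τbar)) - 1
      - M.Ch / (M.p * M.ca * M.lam) = 0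

end CachingModel

open Classical in
/-- The policy for `C_h = 0`, with threshold `τs`. -/
noncomputable def alwaysCachePolicy (τs : ℝ) : CachingState → CachingAction
  | Sum.inl (τ, true) => if (τ : ℝ) ≤ τs then .keep else .fetchKeep
  | Sum.inl (_, false) => .keep
  | Sum.inr true => .fetchKeep
  | Sum.inr false => .idle

open Classical in
/-- The policy for `0 < C_h < I`, with thresholds `τbar < τtil`. In the state `(τbar, 1, 1)` the
policy table lists both `keep` and `discard`; `tie` is the action that is used there. -/
noncomputable def twoThresholdPolicy (tie : CachingAction) (τbar τtil : ℝ) :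
    CachingState → CachingAction
  | Sum.inl (τ, true) =>
      if (τ : ℝ) < τbar then .keep
      else if (τ : ℝ) = τbar then tie
      else if (τ : ℝ) ≤ τtil then .discard
      else .fetchKeep
  | Sum.inl (τ, false) => if (τ : ℝ) ≤ τbar then .keep else .discard
  | Sum.inr true => .fetchKeep
  | Sum.inr false => .idle

open Classical in
/-- The policy for `C_h > I`, with threshold `τ0`. -/
noncomputable def neverCachePolicy (τ0 : ℝ) : CachingState → CachingAction
  | Sum.inl (τ, true) => if (τ : ℝ) ≤ τ0 then .discard else .fetchDiscard
  | Sum.inl (_, false) => .discard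
  | Sum.inr true => .fetchDiscard
  | Sum.inr false => .idle

/-! The proof is a verification argument with an explicit value function. Write `κ = ca * lam`.

Suppose a bounded `h` satisfies Bellman's inequality for every available action, with equality along
a stationary policy. Shift `h` by its bound to get a potential with values in `[0, D]`, weight the
one-step inequality at epoch `k` by the indicator of `t_k ≤ T`, and sum over `k ≥ 1`. The potentials
telescope up to an error of at most `D`, and the expected number of epochs is exactly `βT`. So every
admissible policy has expected cost at least `θT - D`, the given policy has at most `θT + D`, and
both kinds of average follow (`isOptimal_of_bellman`).

One family `relativeValue x y` serves all regimes: copies are kept up to age `x` and served up to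
age `y`. An empty cache has continuation value `V = cf - κy`, so at age `y` serving and discarding
costs as much as a fetch; this forces `θ = pβκy`. Two conditions on `x ≤ y` give Bellman's
inequality (`relativeValue_le_bellmanValue`): `V` equals the gain from holding a fresh copy, and `pκ
* meanShortfall (y - x)`, the expected one-step gain at age `x`, is at most the holding cost per
epoch. Equality in the latter makes `x` a point of indifference.

The regimes are `x = y = tauStar` (no holding cost), the root of the threshold equations, and `x =
0`, `y = tauZero`. In the variables `d = y - x` and `x` the threshold equations decouple: the second
fixes `d` by monotonicity of `meanShortfall`, and the first is then strictly increasing in `x`. -/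

/-! ### Measurability of the controlled dynamics. -/

instance : Finite CachingAction :=
  Finite.of_surjective (fun i : Fin 5 =>
    match i with
    | 0 => CachingAction.keep
    | 1 => .fetchKeep
    | 2 => .discard
    | 3 => .fetchDiscard
    | 4 => .idle) (by
      intro a
      cases a
      exacts [⟨0, rfl⟩, ⟨1, rfl⟩, ⟨2, rfl⟩, ⟨3, rfl⟩, ⟨4, rfl⟩])

instance : MeasurableSingletonClass CachingAction := ⟨fun _ => trivial⟩

theorem measurable_nextState :
    Measurable fun x : (CachingState × (ℝ × Bool)) × CachingAction =>
      nextState x.1.1 x.2 x.1.2 := by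
  refine measurable_from_prod_countable_left fun a => ?_
  have key : Measurable ((fun x : CachingState × (ℝ × Bool) => nextState x.1 a x.2) ∘
      (MeasurableEquiv.sumProdDistrib (ℝ≥0 × Bool) Bool (ℝ × Bool)).symm) := by
    refine measurable_fun_sum ?_ ?_
    · cases a <;>
        simp only [Function.comp_def, MeasurableEquiv.sumProdDistrib, nextState] <;>
        first
          | exact measurable_inl.comp (by fun_prop)
          | exact measurable_inr.comp (by fun_prop)
    · cases a <;>
        simp only [Function.comp_def, MeasurableEquiv.sumProdDistrib, nextState] <;>
        first
          | exact measurable_inl.comp (by fun_prop)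
          | exact measurable_inr.comp (by fun_prop)
  simpa [Function.comp_def] using
    key.comp (MeasurableEquiv.sumProdDistrib (ℝ≥0 × Bool) Bool (ℝ × Bool)).measurable

theorem measurable_nextState_rule {f : CachingState → CachingAction} (hf : Measurable f) :
    Measurable fun x : CachingState × (ℝ × Bool) => nextState x.1 (f x.1) x.2 :=
  measurable_nextState.comp (measurable_id.prodMk (hf.comp measurable_fst))

theorem requestEpoch_succ (ω : ℕ → ℝ × Bool) (k : ℕ) :
    requestEpoch ω (k + 1) = requestEpoch ω k + (ω k).1 := by
  simp [requestEpoch, Finset.sum_range_succ]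

theorem measurable_requestEpoch (k : ℕ) : Measurable fun ω => requestEpoch ω k := by
  unfold requestEpoch
  fun_prop

theorem requestEpoch_congr {ω ω' : ℕ → ℝ × Bool} {k : ℕ} (h : ∀ i < k, ω i = ω' i) :
    requestEpoch ω k = requestEpoch ω' k :=
  Finset.sum_congr rfl fun i hi => by rw [h i (Finset.mem_range.1 hi)]

theorem measurable_stateAt {π : ℕ → CachingState → CachingAction} (hπ : ∀ k, Measurable (π k))
    (s : CachingState) (k : ℕ) : Measurable fun ω => stateAt π s ω k := by
  induction k with
  | zero => exact measurable_const
  | succ k ih => exact (measurable_nextState_rule (hπ k)).comp (ih.prodMk (measurable_pi_apply k))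

theorem stateAt_congr (π : ℕ → CachingState → CachingAction) (s : CachingState)
    {ω ω' : ℕ → ℝ × Bool} {k : ℕ} (h : ∀ i < k, ω i = ω' i) :
    stateAt π s ω k = stateAt π s ω' k := by
  induction k with
  | zero => rfl
  | succ k ih =>
    simp only [stateAt]
    rw [ih fun i hi => h i (hi.trans k.lt_succ_self), h k k.lt_succ_self]

/-! ### Independence of the driving sequence and exponential integrals. -/

namespace CachingModel

variable (M : CachingModel)

instance : IsProbabilityMeasure M.law := by
  unfold law
  infer_instance

theorem measurable_stageCost :
    Measurable fun x : CachingState × CachingAction => M.stageCost x.1 x.2 := by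
  refine measurable_from_prod_countable_left fun a => ?_
  refine measurable_fun_sum (measurable_from_prod_countable_left fun b => ?_)
    (measurable_of_countable _)
  cases a <;> cases b <;> simp only [stageCost] <;> fun_prop

/-- The past before epoch `k` is independent of `ω k`, so `ω k` may be integrated out with the past
frozen. This takes the place of the Markov property throughout. -/
theorem lintegral_law_adapted {E : Type*} [MeasurableSpace E] (k : ℕ)
    {Y : (ℕ → ℝ × Bool) → E} (hY : Measurable Y)
    (hdep : ∀ ω ω' : ℕ → ℝ × Bool, (∀ i < k, ω i = ω' i) → Y ω = Y ω')
    {f : E × (ℝ × Bool) → ℝ≥0∞} (hf : Measurable f) :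
    ∫⁻ ω, f (Y ω, ω k) ∂M.law = ∫⁻ ω, ∫⁻ w, f (Y ω, w) ∂M.noise ∂M.law := by
  have hind : iIndepFun (fun (i : ℕ) (ω : ℕ → ℝ × Bool) => ω i) M.law :=
    iIndepFun_infinitePi (P := fun _ => M.noise) (X := fun _ x => x) fun _ => measurable_id
  have h1 := hind.indepFun_finset (Finset.range k) {k} (by simp) fun i => measurable_pi_apply i
  -- The padding value is harmless: `Y` reads only the coordinates below `k`.
  let ext : (Finset.range k → ℝ × Bool) → ℕ → ℝ × Bool :=
    fun x i => if h : i ∈ Finset.range k then x ⟨i, h⟩ else (0, false)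
  have hext : Measurable ext := by
    refine measurable_pi_lambda _ fun i => ?_
    by_cases h : i ∈ Finset.range k
    · simp only [ext, h, dite_true]; fun_prop
    · simp only [ext, h, dite_false]; fun_prop
  have h2 : IndepFun Y (fun ω => ω k) M.law := by
    have := h1.comp (φ := Y ∘ ext) (hY.comp hext)
      (measurable_pi_apply (⟨k, Finset.mem_singleton_self k⟩ : ({k} : Finset ℕ)))
    refine this.congr (Eventually.of_forall fun ω => ?_) (Eventually.of_forall fun ω => rfl)
    refine hdep _ _ fun i hi => ?_
    simp [ext, hi]
  have hk : Measure.map (fun ω : ℕ → ℝ × Bool => ω k) M.law = M.noise :=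
    Measure.infinitePi_map_eval (fun _ => M.noise) k
  have h3 := (indepFun_iff_map_prod_eq_prod_map_map hY.aemeasurable
    (measurable_pi_apply k).aemeasurable).1 h2
  have : IsProbabilityMeasure (Measure.map Y M.law) :=
    Measure.isProbabilityMeasure_map hY.aemeasurable
  rw [hk] at h3
  rw [← lintegral_map (μ := M.law) (g := fun ω => (Y ω, ω k)) hf
    (hY.prodMk (measurable_pi_apply k)), h3, lintegral_prod _ hf.aemeasurable,
    lintegral_map hf.lintegral_prod_right' hY]

theorem ae_exp_nonneg : ∀ᵐ x ∂(expMeasure M.beta), 0 ≤ x := by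
  rw [ae_iff]
  simp only [not_le]
  change expMeasure M.beta (Set.Iio 0) = 0
  rw [expMeasure, gammaMeasure, withDensity_apply _ measurableSet_Iio]
  exact lintegral_exponentialPDF_of_nonpos le_rfl

theorem ae_noise_nonneg : ∀ᵐ w ∂M.noise, 0 ≤ w.1 := by
  have := isProbabilityMeasure_expMeasure M.beta_pos
  exact (Measure.quasiMeasurePreserving_fst (μ := expMeasure M.beta)
    (ν := bernoulliMeasure true false ⟨M.p, M.p_pos.le, M.p_le_one⟩)).ae M.ae_exp_nonneg

theorem ae_law_nonneg : ∀ᵐ ω ∂M.law, ∀ k, 0 ≤ (ω k).1 := by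
  refine ae_all_iff.2 fun k => ?_
  exact (measurePreserving_eval_infinitePi (fun _ => M.noise) k).quasiMeasurePreserving.ae
    M.ae_noise_nonneg

/-- Integrals against the driving noise, with the request indicator integrated out. -/
theorem integral_noise {g : ℝ × Bool → ℝ} (hg : Integrable g M.noise) :
    ∫ w, g w ∂M.noise =
      ∫ x, (M.p * g (x, true) + (1 - M.p) * g (x, false)) ∂(expMeasure M.beta) := by
  have := isProbabilityMeasure_expMeasure M.beta_pos
  unfold noise at hg ⊢
  rw [integral_prod _ hg]
  refine integral_congr_ae (Eventually.of_forall fun x => ?_)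
  simp [integral_bernoulliMeasure]

/-- The exponential density turns the integral into one over `[0, r]`, evaluated by an
antiderivative `G`; values of `f` on negative arguments do not matter. -/
theorem integral_expMeasure {f : ℝ → ℝ} {r : ℝ} (hr : 0 ≤ r) {ψ G : ℝ → ℝ}
    (hle : ∀ x, 0 ≤ x → x ≤ r → f x = ψ x) (hlt : ∀ x, r < x → f x = 0)
    (hψ : Continuous ψ)
    (hG : ∀ x, HasDerivAt G (M.beta * Real.exp (-M.beta * x) * ψ x) x) :
    ∫ x, f x ∂(expMeasure M.beta) = G r - G 0 := by
  have hd : expMeasure M.beta = volume.withDensity (exponentialPDF M.beta) := rfl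
  have hm : Measurable (exponentialPDF M.beta) :=
    (measurable_exponentialPDFReal M.beta).ennreal_ofReal
  rw [hd, integral_withDensity_eq_integral_toReal_smul hm
    (Eventually.of_forall fun x => ENNReal.ofReal_lt_top)]
  have hc : Continuous fun x => M.beta * Real.exp (-M.beta * x) * ψ x := by fun_prop
  rw [← intervalIntegral.integral_eq_sub_of_hasDerivAt (fun x _ => hG x)
    (hc.intervalIntegrable 0 r), intervalIntegral.integral_of_le hr,
    ← integral_Icc_eq_integral_Ioc, ← integral_indicator measurableSet_Icc]
  refine integral_congr_ae (Eventually.of_forall fun x => ?_)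
  simp only [exponentialPDF_eq]
  by_cases h0 : 0 ≤ x
  · rw [if_pos h0, ENNReal.toReal_ofReal (by have := M.beta_pos; positivity)]
    by_cases h1 : x ≤ r
    · rw [Set.indicator_of_mem (Set.mem_Icc.2 ⟨h0, h1⟩), hle x h0 h1]
      simp
    · rw [Set.indicator_of_notMem (fun h => h1 h.2), hlt x (not_le.1 h1)]
      simp
  · rw [if_neg h0, Set.indicator_of_notMem (fun h => h0 h.1)]
    simp

theorem hasDerivAt_exp_neg_beta (x : ℝ) :
    HasDerivAt (fun x => Real.exp (-M.beta * x)) (Real.exp (-M.beta * x) * -M.beta) x := by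
  simpa using ((hasDerivAt_id x).const_mul (-M.beta)).exp

/-- `E[(r - Δ)⁺]` as a function of `r ≥ 0`. -/
noncomputable def meanShortfall (r : ℝ) : ℝ := r - (1 - Real.exp (-M.beta * r)) / M.beta

theorem integral_shortfall (r : ℝ) :
    ∫ x, max (r - x) 0 ∂(expMeasure M.beta) = M.meanShortfall (max r 0) := by
  have hβ := M.beta_pos
  have key : ∀ r : ℝ, 0 ≤ r →
      ∫ x, max (r - x) 0 ∂(expMeasure M.beta) = M.meanShortfall r := by
    intro r hr
    rw [M.integral_expMeasure hr (ψ := fun x => r - x)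
      (G := fun x => -(r - x) * Real.exp (-M.beta * x) + Real.exp (-M.beta * x) / M.beta)
      (fun x _ h => max_eq_left (by linarith)) (fun x h => max_eq_right (by linarith))
      (by fun_prop) fun x => ?_]
    · simp [meanShortfall]; field_simp; ring
    · have e := M.hasDerivAt_exp_neg_beta x
      refine (((((hasDerivAt_id x).const_sub r).neg).mul e).add
        (e.div_const M.beta)).congr_deriv ?_
      simp; field_simp; ring
  -- Delays are almost surely nonnegative, so a negative `r` gives the same integral as `r = 0`.
  rcases le_total 0 r with hr | hr
  · rw [max_eq_left hr, key r hr]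
  · have hd : (fun x => max (r - x) 0) =ᵐ[expMeasure M.beta] fun x => max (0 - x) 0 := by
      filter_upwards [M.ae_exp_nonneg] with x hx
      rw [max_eq_right (by linarith), max_eq_right (by linarith)]
    rw [integral_congr_ae hd, max_eq_right hr, key 0 le_rfl]

theorem integral_sq_shortfall (r : ℝ) :
    ∫ x, max (r - x) 0 ^ 2 ∂(expMeasure M.beta) =
      max r 0 ^ 2 - 2 / M.beta * M.meanShortfall (max r 0) := by
  have hβ := M.beta_pos
  have key : ∀ r : ℝ, 0 ≤ r → ∫ x, max (r - x) 0 ^ 2 ∂(expMeasure M.beta) =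
      r ^ 2 - 2 / M.beta * M.meanShortfall r := by
    intro r hr
    rw [M.integral_expMeasure hr (ψ := fun x => (r - x) ^ 2)
      (G := fun x => (-(r - x) ^ 2 + 2 / M.beta * (r - x) - 2 / M.beta ^ 2) *
        Real.exp (-M.beta * x))
      (fun x _ h => by rw [max_eq_left (by linarith)])
      (fun x h => by rw [max_eq_right (by linarith)]; simp)
      (by fun_prop) fun x => ?_]
    · simp [meanShortfall]; field_simp; ring
    · have e := M.hasDerivAt_exp_neg_beta x
      have l := (hasDerivAt_id x).const_sub r
      refine (((((l.pow 2).neg).add (l.const_mul (2 / M.beta))).sub_const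
        (2 / M.beta ^ 2)).mul e).congr_deriv ?_
      simp; field_simp; ring
  rcases le_total 0 r with hr | hr
  · rw [max_eq_left hr, key r hr]
  · have hd : (fun x => max (r - x) 0 ^ 2) =ᵐ[expMeasure M.beta] fun x => max (0 - x) 0 ^ 2 := by
      filter_upwards [M.ae_exp_nonneg] with x hx
      rw [max_eq_right (by linarith), max_eq_right (by linarith)]
    rw [integral_congr_ae hd, max_eq_right hr, key 0 le_rfl]

end CachingModel

/-! ### The expected number of epochs up to time `T`. -/

/-- The indicator of the times up to `T`. -/
noncomputable def upTo (T t : ℝ) : ℝ≥0∞ := (Set.Iic T).indicator 1 t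

theorem upTo_of_le {T t : ℝ} (h : t ≤ T) : upTo T t = 1 := by simp [upTo, h]

theorem upTo_of_lt {T t : ℝ} (h : T < t) : upTo T t = 0 := by simp [upTo, h]

@[fun_prop]
theorem measurable_upTo (T : ℝ) : Measurable (upTo T) :=
  measurable_one.indicator measurableSet_Iic

theorem upTo_anti (T : ℝ) {s t : ℝ} (h : s ≤ t) : upTo T t ≤ upTo T s := by
  rcases le_or_gt t T with ht | ht
  · rw [upTo_of_le ht, upTo_of_le (h.trans ht)]
  · rw [upTo_of_lt ht]
    exact zero_le

theorem epochCount_eq (ω : ℕ → ℝ × Bool) (T : ℝ) :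
    epochCount ω T = ∑' k : ℕ, upTo T (requestEpoch ω (k + 1)) := by
  refine tsum_congr fun k => ?_
  by_cases h : requestEpoch ω (k + 1) ≤ T
  · rw [if_pos h, upTo_of_le h]
  · rw [if_neg h, upTo_of_lt (not_le.1 h)]

namespace CachingModel

variable (M : CachingModel)

/-- The expected number of epochs `t_i`, `i ≥ k`, up to `T`, given that `t_k = t`. -/
noncomputable def expectedRemaining (T t : ℝ) : ℝ≥0∞ :=
  upTo T t * ENNReal.ofReal (1 + M.beta * (T - t))

@[fun_prop]
theorem measurable_expectedRemaining (T : ℝ) : Measurable (M.expectedRemaining T) := by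
  unfold expectedRemaining
  fun_prop

theorem lintegral_noise_fst {f : ℝ → ℝ≥0∞} (hf : Measurable f) :
    ∫⁻ w, f w.1 ∂M.noise = ∫⁻ x, f x ∂(expMeasure M.beta) := by
  have := isProbabilityMeasure_expMeasure M.beta_pos
  unfold noise
  rw [lintegral_prod _ (by fun_prop)]
  simp

/-- The renewal equation: the affine function `1 + β(T - t)`, cut off after `T`, exceeds its mean
after one exponential delay by exactly the epoch at `t` itself. -/
theorem expectedRemaining_eq (T t : ℝ) :
    M.expectedRemaining T t =
      ∫⁻ w, M.expectedRemaining T (t + w.1) ∂M.noise + upTo T t := by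
  have hβ := M.beta_pos
  have := isProbabilityMeasure_expMeasure M.beta_pos
  rcases le_or_gt t T with ht | ht
  · rw [M.lintegral_noise_fst (f := fun x => M.expectedRemaining T (t + x)) (by fun_prop)]
    set r := T - t with hr
    have hr0 : 0 ≤ r := sub_nonneg.2 ht
    let f : ℝ → ℝ := (Set.Iic r).indicator fun x => 1 + M.beta * (r - x)
    have hfm : Measurable f := Measurable.indicator (by fun_prop) measurableSet_Iic
    have hf0 : ∀ x, 0 ≤ f x := fun x => Set.indicator_nonneg (fun y (hy : y ≤ r) => by
      have : 0 ≤ M.beta * (r - y) := mul_nonneg hβ.le (sub_nonneg.2 hy)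
      linarith) x
    have h1 : ∀ x, M.expectedRemaining T (t + x) = ENNReal.ofReal (f x) := by
      intro x
      rcases le_or_gt x r with hx | hx
      · have : f x = 1 + M.beta * (r - x) := Set.indicator_of_mem (Set.mem_Iic.2 hx) _
        rw [this, expectedRemaining, upTo_of_le (by linarith), one_mul, hr]
        congr 1; ring
      · have : f x = 0 := Set.indicator_of_notMem (by simpa using hx) _
        rw [this, expectedRemaining, upTo_of_lt (by linarith)]
        simp
    have hint : Integrable f (expMeasure M.beta) := by
      refine Integrable.of_bound hfm.aestronglyMeasurable (1 + M.beta * r) ?_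
      filter_upwards [M.ae_exp_nonneg] with x hx
      rw [Real.norm_of_nonneg (hf0 x)]
      have hr1 : 0 ≤ M.beta * r := by positivity
      have hx1 : 0 ≤ M.beta * x := by positivity
      simp only [f]
      by_cases hxr : x ∈ Set.Iic r
      · rw [Set.indicator_of_mem hxr]
        linarith
      · rw [Set.indicator_of_notMem hxr]
        linarith
    have h2 : ∫ x, f x ∂(expMeasure M.beta) = M.beta * r := by
      rw [M.integral_expMeasure hr0 (ψ := fun x => 1 + M.beta * (r - x))
        (G := fun x => -M.beta * (r - x) * Real.exp (-M.beta * x))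
        (fun x _ h => Set.indicator_of_mem (Set.mem_Iic.2 h) _)
        (fun x h => Set.indicator_of_notMem (by simpa using h) _)
        (by fun_prop) fun x => ?_]
      · simp
      · refine ((((hasDerivAt_id x).const_sub r).const_mul (-M.beta)).mul
          (M.hasDerivAt_exp_neg_beta x)).congr_deriv ?_
        simp; ring
    simp_rw [h1]
    rw [← ofReal_integral_eq_lintegral_ofReal hint (Eventually.of_forall hf0), h2,
      expectedRemaining, upTo_of_le ht, one_mul, ENNReal.ofReal_add zero_le_one (by positivity),
      ENNReal.ofReal_one, add_comm]
  · have : ∫⁻ w, M.expectedRemaining T (t + w.1) ∂M.noise = 0 := by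
      rw [lintegral_eq_zero_iff (by fun_prop)]
      filter_upwards [M.ae_noise_nonneg] with w hw
      simp [expectedRemaining, upTo_of_lt (show T < t + w.1 by linarith)]
    rw [this, expectedRemaining, upTo_of_lt ht]
    simp

/-- The probability that the `k`-th epoch occurs up to time `T`. -/
noncomputable def epochProb (T : ℝ) (k : ℕ) : ℝ≥0∞ :=
  ∫⁻ ω, upTo T (requestEpoch ω k) ∂M.law

/-- The renewal equation iterated `N` times; each iteration splits off one epoch probability. -/
theorem sum_epochProb_add (T : ℝ) (N : ℕ) :
    ∑ k ∈ Finset.range N, M.epochProb T k +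
      ∫⁻ ω, M.expectedRemaining T (requestEpoch ω N) ∂M.law = M.expectedRemaining T 0 := by
  induction N with
  | zero => simp [requestEpoch]
  | succ N ih =>
    have hm := measurable_requestEpoch N
    have h1 : ∫⁻ ω, M.expectedRemaining T (requestEpoch ω N) ∂M.law =
        ∫⁻ ω, M.expectedRemaining T (requestEpoch ω (N + 1)) ∂M.law + M.epochProb T N := by
      simp_rw [requestEpoch_succ]
      rw [M.lintegral_law_adapted N hm (fun _ _ h => requestEpoch_congr h)
        (f := fun x => M.expectedRemaining T (x.1 + x.2.1)) (by fun_prop), epochProb,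
        ← lintegral_add_right _ (by fun_prop)]
      exact lintegral_congr fun ω => M.expectedRemaining_eq T _
    rw [← ih, h1, Finset.sum_range_succ]
    ring

theorem ae_requestEpoch_nonneg : ∀ᵐ ω ∂M.law, ∀ k, 0 ≤ requestEpoch ω k := by
  filter_upwards [M.ae_law_nonneg] with ω hω k
  exact Finset.sum_nonneg fun i _ => hω i

theorem tsum_epochProb {T : ℝ} (hT : 0 ≤ T) :
    ∑' k, M.epochProb T k = 1 + ENNReal.ofReal (M.beta * T) := by
  have hβ := M.beta_pos
  have h0 : M.expectedRemaining T 0 = 1 + ENNReal.ofReal (M.beta * T) := by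
    rw [expectedRemaining, upTo_of_le hT, one_mul, sub_zero,
      ENNReal.ofReal_add zero_le_one (by positivity), ENNReal.ofReal_one]
  have hle : ∑' k, M.epochProb T k ≤ M.expectedRemaining T 0 := by
    refine ENNReal.tsum_le_of_sum_range_le fun N => ?_
    rw [← M.sum_epochProb_add T N]
    exact le_self_add
  have hfin : M.expectedRemaining T 0 ≠ ∞ := by rw [h0]; simp
  have hq : Tendsto (M.epochProb T) atTop (𝓝 0) :=
    ENNReal.tendsto_atTop_zero_of_tsum_ne_top (ne_top_of_le_ne_top hfin hle)
  -- The remainder is at most `(1 + βT)` times the probability of `t_N ≤ T`, and those probabilities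
  -- are summable by the bound `hle`.
  have he : Tendsto (fun N => ∫⁻ ω, M.expectedRemaining T (requestEpoch ω N) ∂M.law) atTop
      (𝓝 0) := by
    have hq' : Tendsto (fun N => ENNReal.ofReal (1 + M.beta * T) * M.epochProb T N) atTop
        (𝓝 0) := by
      simpa using ENNReal.Tendsto.const_mul hq (Or.inr ENNReal.ofReal_ne_top)
    refine tendsto_of_tendsto_of_tendsto_of_le_of_le tendsto_const_nhds hq'
      (fun _ => zero_le) fun N => ?_
    have hm := measurable_requestEpoch N
    dsimp only
    rw [epochProb, ← lintegral_const_mul _ (by fun_prop)]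
    refine lintegral_mono_ae ?_
    filter_upwards [M.ae_requestEpoch_nonneg] with ω hω
    rw [expectedRemaining, mul_comm]
    gcongr
    have := hω N
    linarith
  have hsum := (ENNReal.tendsto_nat_tsum (M.epochProb T)).add he
  simp_rw [M.sum_epochProb_add T, add_zero] at hsum
  rw [← h0]
  exact tendsto_nhds_unique hsum tendsto_const_nhds

theorem epochProb_zero {T : ℝ} (hT : 0 ≤ T) : M.epochProb T 0 = 1 := by
  simp [epochProb, requestEpoch, upTo_of_le hT]

theorem tsum_epochProb_succ {T : ℝ} (hT : 0 ≤ T) :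
    ∑' k, M.epochProb T (k + 1) = ENNReal.ofReal (M.beta * T) := by
  have h := M.tsum_epochProb hT
  rw [tsum_eq_zero_add' ENNReal.summable, M.epochProb_zero hT] at h
  exact (ENNReal.add_right_inj ENNReal.one_ne_top).1 h

theorem lintegral_epochCount {T : ℝ} (hT : 0 ≤ T) :
    ∫⁻ ω, epochCount ω T ∂M.law = ENNReal.ofReal (M.beta * T) := by
  simp_rw [epochCount_eq]
  rw [lintegral_tsum fun k => by
    have := measurable_requestEpoch (k + 1)
    fun_prop]
  exact M.tsum_epochProb_succ hT

end CachingModel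

theorem measurable_upTo_requestEpoch (T : ℝ) (k : ℕ) :
    Measurable fun ω => upTo T (requestEpoch ω k) :=
  (measurable_upTo T).comp (measurable_requestEpoch k)

/-! ### Bounds on the expected cost from a bounded potential. -/

namespace CachingModel

variable (M : CachingModel)

/-- The expected cost at epoch `k`, counted if the epoch occurs up to time `T`. -/
noncomputable def epochCost (π : ℕ → CachingState → CachingAction) (s : CachingState) (T : ℝ)
    (k : ℕ) : ℝ≥0∞ :=
  ∫⁻ ω, upTo T (requestEpoch ω k) *
    ENNReal.ofReal (M.stageCost (stateAt π s ω k) (π k (stateAt π s ω k))) ∂M.law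

theorem measurable_epochCost_integrand {π : ℕ → CachingState → CachingAction}
    (hπ : ∀ k, Measurable (π k)) (s : CachingState) (T : ℝ) (k : ℕ) :
    Measurable fun ω => upTo T (requestEpoch ω k) *
      ENNReal.ofReal (M.stageCost (stateAt π s ω k) (π k (stateAt π s ω k))) := by
  have h1 := measurable_requestEpoch k
  have h2 := measurable_stateAt hπ s k
  have h3 := M.measurable_stageCost.comp (h2.prodMk ((hπ k).comp h2))
  exact ((measurable_upTo T).comp h1).mul h3.ennreal_ofReal

theorem lintegral_totalCost {π : ℕ → CachingState → CachingAction}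
    (hπ : ∀ k, Measurable (π k)) (s : CachingState) (T : ℝ) :
    ∫⁻ ω, M.totalCost π s ω T ∂M.law = ∑' k, M.epochCost π s T (k + 1) := by
  unfold epochCost
  rw [← lintegral_tsum fun k => (M.measurable_epochCost_integrand hπ s T (k + 1)).aemeasurable]
  refine lintegral_congr fun ω => tsum_congr fun k => ?_
  by_cases h : requestEpoch ω (k + 1) ≤ T
  · rw [if_pos h, upTo_of_le h, one_mul]
  · rw [if_neg h, upTo_of_lt (not_le.1 h), zero_mul]

section Potential

variable {π : ℕ → CachingState → CachingAction} (g : CachingState → ℝ≥0∞)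

/-- The expected potential at epoch `j`, counted if epoch `k` occurs up to time `T`. -/
noncomputable def meanPotential (π : ℕ → CachingState → CachingAction) (s : CachingState)
    (T : ℝ) (k j : ℕ) : ℝ≥0∞ :=
  ∫⁻ ω, upTo T (requestEpoch ω k) * g (stateAt π s ω j) ∂M.law

variable {g}

theorem measurable_meanPotential_integrand (hπ : ∀ k, Measurable (π k)) (hg : Measurable g)
    (s : CachingState) (T : ℝ) (k j : ℕ) :
    Measurable fun ω => upTo T (requestEpoch ω k) * g (stateAt π s ω j) :=
  ((measurable_upTo T).comp (measurable_requestEpoch k)).mul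
    (hg.comp (measurable_stateAt hπ s j))

/-- The weight involves `t_k`, not `t_{k+1}`: the latter depends on the same delay as the state at
epoch `k + 1`, which would block integrating that delay out. -/
theorem meanPotential_succ_right (hπ : ∀ k, Measurable (π k)) (hg : Measurable g)
    (s : CachingState) (T : ℝ) (k : ℕ) :
    M.meanPotential g π s T k (k + 1) =
      ∫⁻ ω, upTo T (requestEpoch ω k) *
        ∫⁻ w, g (nextState (stateAt π s ω k) (π k (stateAt π s ω k)) w) ∂M.noise ∂M.law := by
  have hn := measurable_nextState_rule (hπ k)
  have h1 := measurable_requestEpoch k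
  have h2 := measurable_stateAt hπ s k
  have h := M.lintegral_law_adapted k (h1.prodMk h2)
    (fun ω ω' h => by rw [requestEpoch_congr h, stateAt_congr π s h])
    (f := fun x => upTo T x.1.1 * g (nextState x.1.2 (π k x.1.2) x.2))
    (((measurable_upTo T).comp (measurable_fst.comp measurable_fst)).mul
      (hg.comp (hn.comp ((measurable_snd.comp measurable_fst).prodMk measurable_snd))))
  refine h.trans (lintegral_congr fun ω => ?_)
  have hm : Measurable fun w =>
      g (nextState (stateAt π s ω k) (π k (stateAt π s ω k)) w) :=
    hg.comp (hn.comp measurable_prodMk_left)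
  rw [← lintegral_const_mul _ hm]

theorem meanPotential_le {D : ℝ≥0∞} (hD : ∀ s, g s ≤ D) (s : CachingState) (T : ℝ) (k j : ℕ) :
    M.meanPotential g π s T k j ≤ D * M.epochProb T k := by
  have hm := measurable_requestEpoch k
  rw [epochProb, ← lintegral_const_mul _ (by fun_prop)]
  refine lintegral_mono fun ω => ?_
  rw [mul_comm]
  gcongr
  exact hD _

theorem meanPotential_succ_left_le (s : CachingState) (T : ℝ) (k j : ℕ) :
    M.meanPotential g π s T (k + 1) j ≤ M.meanPotential g π s T k j := by
  refine lintegral_mono_ae ?_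
  filter_upwards [M.ae_law_nonneg] with ω hω
  gcongr
  refine upTo_anti T ?_
  rw [requestEpoch_succ]
  linarith [hω k]

/-- Replacing the weight at `t_k` by the one at `t_{k+1}` loses at most `D` on the event `t_k ≤ T <
t_{k+1}`. Written additively to avoid truncated subtraction; the `D` terms telescope when summed. -/
theorem meanPotential_add_le (hπ : ∀ k, Measurable (π k)) (hg : Measurable g)
    {D : ℝ≥0∞} (hD : ∀ s, g s ≤ D) (s : CachingState) (T : ℝ) (k j : ℕ) :
    M.meanPotential g π s T k j + D * M.epochProb T (k + 1) ≤
      M.meanPotential g π s T (k + 1) j + D * M.epochProb T k := by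
  have h1 := measurable_requestEpoch k
  have h2 := measurable_requestEpoch (k + 1)
  unfold meanPotential epochProb
  rw [← lintegral_const_mul _ (by fun_prop), ← lintegral_const_mul _ (by fun_prop),
    ← lintegral_add_left (measurable_meanPotential_integrand hπ hg s T k j),
    ← lintegral_add_left (measurable_meanPotential_integrand hπ hg s T (k + 1) j)]
  refine lintegral_mono_ae ?_
  filter_upwards [M.ae_law_nonneg] with ω hω
  have hle : requestEpoch ω k ≤ requestEpoch ω (k + 1) := by
    rw [requestEpoch_succ]
    linarith [hω k]
  rcases le_or_gt (requestEpoch ω (k + 1)) T with h | h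
  · rw [upTo_of_le h, upTo_of_le (hle.trans h)]
  · rw [upTo_of_lt h]
    simp only [mul_zero, add_zero, zero_mul, zero_add]
    rw [mul_comm]
    gcongr
    exact hD _

theorem tsum_meanPotential_ne_top {D : ℝ≥0∞} (hD : ∀ s, g s ≤ D) (hDt : D ≠ ∞)
    (s : CachingState) {T : ℝ} (hT : 0 ≤ T) (i : ℕ) (j : ℕ → ℕ) :
    ∑' k, M.meanPotential g π s T (k + i) (j k) ≠ ∞ := by
  refine ne_top_of_le_ne_top ?_
    (ENNReal.tsum_le_tsum fun k => M.meanPotential_le hD s T (k + i) (j k))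
  rw [ENNReal.tsum_mul_left]
  refine ENNReal.mul_ne_top hDt (ne_top_of_le_ne_top ?_
    (ENNReal.tsum_comp_le_tsum_of_injective (add_left_injective i) (M.epochProb T)))
  rw [M.tsum_epochProb hT]
  simp

theorem epochProb_le_one (T : ℝ) (k : ℕ) : M.epochProb T k ≤ 1 := by
  refine (lintegral_mono fun ω => ?_).trans (by simp : ∫⁻ _, (1 : ℝ≥0∞) ∂M.law ≤ 1)
  exact Set.indicator_le_self' (fun _ _ => zero_le) _

/-- Summing the one-step inequalities cancels the potentials, apart from the change of weight, which
costs at most `D` times the probability of `t_1 ≤ T`. -/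
theorem mul_time_le_lintegral_totalCost (hπ : ∀ k, Measurable (π k)) (hg : Measurable g)
    {D η : ℝ≥0∞} (hD : ∀ s, g s ≤ D) (hDt : D ≠ ∞)
    (hstep : ∀ k s, η + g s ≤ ENNReal.ofReal (M.stageCost s (π k s)) +
      ∫⁻ w, g (nextState s (π k s) w) ∂M.noise)
    (s : CachingState) {T : ℝ} (hT : 0 ≤ T) :
    η * ENNReal.ofReal (M.beta * T) ≤ ∫⁻ ω, M.totalCost π s ω T ∂M.law + D := by
  have hone : ∀ k, η * M.epochProb T k + M.meanPotential g π s T k k ≤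
      M.epochCost π s T k + M.meanPotential g π s T k (k + 1) := by
    intro k
    have h1 : Measurable fun ω => η * upTo T (requestEpoch ω k) :=
      (measurable_upTo_requestEpoch T k).const_mul η
    rw [M.meanPotential_succ_right hπ hg, epochProb, epochCost, meanPotential,
      ← lintegral_const_mul _ (measurable_upTo_requestEpoch T k),
      ← lintegral_add_left h1,
      ← lintegral_add_left (M.measurable_epochCost_integrand hπ s T k)]
    refine lintegral_mono fun ω => ?_
    rw [mul_comm η, ← mul_add, ← mul_add]
    exact mul_le_mul_right (hstep k _) _
  -- The sum starts at epoch 1, because the cost at epoch 0 is not counted.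
  have hsum := ENNReal.tsum_le_tsum fun k => hone (k + 1)
  rw [ENNReal.tsum_add, ENNReal.tsum_add, ENNReal.tsum_mul_left, M.tsum_epochProb_succ hT,
    ← M.lintegral_totalCost hπ] at hsum
  have hshift := ENNReal.tsum_le_tsum fun k =>
    M.meanPotential_add_le (π := π) hπ hg hD s T (k + 1) (k + 2)
  rw [ENNReal.tsum_add, ENNReal.tsum_add, ENNReal.tsum_mul_left, ENNReal.tsum_mul_left,
    tsum_eq_zero_add' (f := fun k => M.epochProb T (k + 1)) ENNReal.summable, mul_add,
    ← add_assoc] at hshift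
  -- Cancellation in `ℝ≥0∞` needs finite tails; this is where the finite expected number of epochs
  -- enters.
  have hqfin : D * ∑' k, M.epochProb T (k + 1 + 1) ≠ ∞ := by
    refine ENNReal.mul_ne_top hDt (ne_top_of_le_ne_top ?_
      (ENNReal.tsum_comp_le_tsum_of_injective (add_left_injective 2) (M.epochProb T)))
    rw [M.tsum_epochProb hT]
    simp
  have hshift' := (ENNReal.add_le_add_iff_right hqfin).1 hshift
  rw [tsum_eq_zero_add' (f := fun k => M.meanPotential g π s T (k + 1) (k + 1))
    ENNReal.summable] at hsum
  have hafin := M.tsum_meanPotential_ne_top (π := π) hD hDt s hT 2 fun k => k + 2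
  refine (ENNReal.add_le_add_iff_right hafin).1 ?_
  calc η * ENNReal.ofReal (M.beta * T) + ∑' k, M.meanPotential g π s T (k + 2) (k + 2)
      ≤ _ := by
        gcongr
        exact le_add_self
    _ ≤ _ := hsum
    _ ≤ ∫⁻ ω, M.totalCost π s ω T ∂M.law +
        (∑' k, M.meanPotential g π s T (k + 2) (k + 2) + D * M.epochProb T (0 + 1)) := by
        gcongr
    _ ≤ ∫⁻ ω, M.totalCost π s ω T ∂M.law +
        (∑' k, M.meanPotential g π s T (k + 2) (k + 2) + D * 1) := by
        gcongr
        exact M.epochProb_le_one T _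
    _ = _ := by ring

/-- In this direction the change of weight has a favourable sign; only the initial potential at
epoch 1, at most `D`, is left over. -/
theorem lintegral_totalCost_le_mul_time (hπ : ∀ k, Measurable (π k)) (hg : Measurable g)
    {D η : ℝ≥0∞} (hD : ∀ s, g s ≤ D) (hDt : D ≠ ∞)
    (hstep : ∀ k s, ENNReal.ofReal (M.stageCost s (π k s)) +
      ∫⁻ w, g (nextState s (π k s) w) ∂M.noise ≤ η + g s)
    (s : CachingState) {T : ℝ} (hT : 0 ≤ T) :
    ∫⁻ ω, M.totalCost π s ω T ∂M.law ≤ η * ENNReal.ofReal (M.beta * T) + D := by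
  have hone : ∀ k, M.epochCost π s T k + M.meanPotential g π s T k (k + 1) ≤
      η * M.epochProb T k + M.meanPotential g π s T k k := by
    intro k
    have h1 : Measurable fun ω => η * upTo T (requestEpoch ω k) :=
      (measurable_upTo_requestEpoch T k).const_mul η
    rw [M.meanPotential_succ_right hπ hg, epochProb, epochCost, meanPotential,
      ← lintegral_const_mul _ (measurable_upTo_requestEpoch T k),
      ← lintegral_add_left (M.measurable_epochCost_integrand hπ s T k),
      ← lintegral_add_left h1]
    refine lintegral_mono fun ω => ?_
    rw [mul_comm η, ← mul_add, ← mul_add]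
    exact mul_le_mul_right (hstep k _) _
  have hsum := ENNReal.tsum_le_tsum fun k => hone (k + 1)
  rw [ENNReal.tsum_add, ENNReal.tsum_add, ENNReal.tsum_mul_left, M.tsum_epochProb_succ hT,
    ← M.lintegral_totalCost hπ, tsum_eq_zero_add'
      (f := fun k => M.meanPotential g π s T (k + 1) (k + 1)) ENNReal.summable] at hsum
  have hafin := M.tsum_meanPotential_ne_top (π := π) hD hDt s hT 2 fun k => k + 2
  refine (ENNReal.add_le_add_iff_right hafin).1 ?_
  calc ∫⁻ ω, M.totalCost π s ω T ∂M.law + ∑' k, M.meanPotential g π s T (k + 2) (k + 2)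
      ≤ ∫⁻ ω, M.totalCost π s ω T ∂M.law + ∑' k, M.meanPotential g π s T (k + 1) (k + 2) := by
        gcongr
        exact M.meanPotential_succ_left_le s T (k + 1) (k + 2)
    _ ≤ _ := hsum
    _ ≤ η * ENNReal.ofReal (M.beta * T) + (D * 1 +
        ∑' k, M.meanPotential g π s T (k + 2) (k + 2)) := by
        gcongr
        refine (M.meanPotential_le hD s T _ _).trans ?_
        gcongr
        exact M.epochProb_le_one T _
    _ = _ := by ring

end Potential

theorem stageCost_nonneg (s : CachingState) (a : CachingAction) : 0 ≤ M.stageCost s a := by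
  have h1 := M.beta_pos
  have h2 := M.ca_pos
  have h3 := M.lam_pos
  have h4 := M.cf_pos
  have h5 := M.Ch_nonneg
  rcases s with ⟨τ, b⟩ | b <;> cases b <;> cases a <;> simp only [stageCost] <;> positivity

theorem measurable_nextState_const (s : CachingState) (a : CachingAction) :
    Measurable fun w => nextState s a w :=
  measurable_nextState.comp (by fun_prop :
    Measurable fun w : ℝ × Bool => ((s, w), a))

theorem integrable_nextState {h : CachingState → ℝ} (hm : Measurable h) {B : ℝ}
    (hB : ∀ s, |h s| ≤ B) (s : CachingState) (a : CachingAction) :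
    Integrable (fun w => h (nextState s a w)) M.noise :=
  Integrable.of_bound (hm.comp (measurable_nextState_const s a)).aestronglyMeasurable B
    (Eventually.of_forall fun _ => hB _)

/-- Adding the bound `B` makes the value function nonnegative, so the real Bellman relation carries
over to the extended nonnegative potentials used above. -/
theorem ofReal_stageCost_add_lintegral {h : CachingState → ℝ} (hm : Measurable h) {B : ℝ}
    (hB : ∀ s, |h s| ≤ B) (θ : ℝ) (s : CachingState) (a : CachingAction) :
    ENNReal.ofReal (M.stageCost s a) +
        ∫⁻ w, ENNReal.ofReal (h (nextState s a w) + B) ∂M.noise =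
      ENNReal.ofReal (M.bellmanValue θ h s a + θ / M.beta + B) := by
  have hi := M.integrable_nextState hm hB s a
  have hnn : ∀ s, 0 ≤ h s + B := fun s => by linarith [neg_abs_le (h s), hB s]
  rw [← ofReal_integral_eq_lintegral_ofReal (f := fun w => h (nextState s a w) + B)
    (hi.add (integrable_const B)) (Eventually.of_forall fun _ => hnn _), ← ENNReal.ofReal_add (M.stageCost_nonneg s a)
    (integral_nonneg fun _ => hnn _), integral_add hi (integrable_const B)]
  simp only [integral_const, probReal_univ, one_smul, bellmanValue]
  congr 1
  ring

/-! ### From bounds at finite `T` to long-run averages; the verification theorem. -/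

theorem ofReal_sub_le_div_time {y : ℝ≥0∞} {θ D b T : ℝ} (hD : 0 ≤ D) (hb : 0 < b) (hT : 0 < T)
    (hlo : ENNReal.ofReal (θ * T) ≤ y + ENNReal.ofReal D) :
    ENNReal.ofReal (θ / b - D / (b * T)) ≤ y / ENNReal.ofReal (b * T) := by
  have hbT : 0 < b * T := by positivity
  rw [ENNReal.le_div_iff_mul_le (Or.inl (by simpa using hbT)) (Or.inl ENNReal.ofReal_ne_top),
    ← ENNReal.ofReal_mul' hbT.le]
  have : (θ / b - D / (b * T)) * (b * T) = θ * T - D := by field_simp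
  rw [this, ENNReal.ofReal_sub _ hD]
  exact tsub_le_iff_right.2 hlo

theorem div_time_le_ofReal_add {y : ℝ≥0∞} {θ D b T : ℝ} (hθ : 0 ≤ θ) (hD : 0 ≤ D) (hb : 0 < b)
    (hT : 0 < T) (hup : y ≤ ENNReal.ofReal (θ * T) + ENNReal.ofReal D) :
    y / ENNReal.ofReal (b * T) ≤ ENNReal.ofReal (θ / b + D / (b * T)) := by
  have hbT : 0 < b * T := by positivity
  refine ENNReal.div_le_of_le_mul ?_
  rw [← ENNReal.ofReal_mul' hbT.le]
  have : (θ / b + D / (b * T)) * (b * T) = θ * T + D := by field_simp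
  rw [this, ENNReal.ofReal_add (by positivity) hD]
  exact hup

theorem tendsto_div_mul_atTop (D : ℝ) {b : ℝ} (hb : 0 < b) :
    Tendsto (fun T : ℝ => D / (b * T)) atTop (𝓝 0) :=
  (tendsto_id.const_mul_atTop hb).const_div_atTop D

theorem tendsto_ofReal_sub_div (θ D : ℝ) {b : ℝ} (hb : 0 < b) :
    Tendsto (fun T : ℝ => ENNReal.ofReal (θ / b - D / (b * T))) atTop
      (𝓝 (ENNReal.ofReal (θ / b))) := by
  refine ENNReal.tendsto_ofReal ?_
  simpa using (tendsto_div_mul_atTop D hb).const_sub (θ / b)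

theorem tendsto_div_time {x : ℝ → ℝ≥0∞} {θ D : ℝ} (hθ : 0 ≤ θ) (hD : 0 ≤ D)
    (hlo : ∀ T, 0 ≤ T → ENNReal.ofReal (θ * T) ≤ x T + ENNReal.ofReal D)
    (hup : ∀ T, 0 ≤ T → x T ≤ ENNReal.ofReal (θ * T) + ENNReal.ofReal D) {b : ℝ} (hb : 0 < b) :
    Tendsto (fun T => x T / ENNReal.ofReal (b * T)) atTop (𝓝 (ENNReal.ofReal (θ / b))) := by
  have h : Tendsto (fun T : ℝ => ENNReal.ofReal (θ / b + D / (b * T))) atTop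
      (𝓝 (ENNReal.ofReal (θ / b))) := by
    refine ENNReal.tendsto_ofReal ?_
    simpa using (tendsto_div_mul_atTop D hb).const_add (θ / b)
  refine tendsto_of_tendsto_of_tendsto_of_le_of_le' (tendsto_ofReal_sub_div θ D hb) h ?_ ?_
  · filter_upwards [eventually_gt_atTop 0] with T hT
    exact ofReal_sub_le_div_time hD hb hT (hlo T hT.le)
  · filter_upwards [eventually_gt_atTop 0] with T hT
    exact div_time_le_ofReal_add hθ hD hb hT (hup T hT.le)

theorem le_liminf_div_time {x : ℝ → ℝ≥0∞} {θ D : ℝ} (hD : 0 ≤ D)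
    (hlo : ∀ T, 0 ≤ T → ENNReal.ofReal (θ * T) ≤ x T + ENNReal.ofReal D) {b : ℝ} (hb : 0 < b) :
    ENNReal.ofReal (θ / b) ≤ liminf (fun T => x T / ENNReal.ofReal (b * T)) atTop := by
  rw [← (tendsto_ofReal_sub_div θ D hb).liminf_eq]
  refine liminf_le_liminf ?_
  filter_upwards [eventually_gt_atTop 0] with T hT
  exact ofReal_sub_le_div_time hD hb hT (hlo T hT.le)

theorem timeAverageCost_def (π : ℕ → CachingState → CachingAction) (s : CachingState) :
    M.timeAverageCost π s = fun T => (∫⁻ ω, M.totalCost π s ω T ∂M.law) / ENNReal.ofReal T :=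
  rfl

/-- A stationary policy is optimal if it attains the minimum in Bellman's equation for a bounded
relative value function. -/
theorem isOptimal_of_bellman {f : CachingState → CachingAction} {θ : ℝ} (hθ : 0 ≤ θ)
    (hf : Measurable f) (hfa : ∀ s, f s ∈ availableActions s)
    {h : CachingState → ℝ} (hm : Measurable h) {B : ℝ} (hB : ∀ s, |h s| ≤ B)
    (hle : ∀ s, ∀ a ∈ availableActions s, h s ≤ M.bellmanValue θ h s a)
    (heq : ∀ s, M.bellmanValue θ h s (f s) = h s) : M.IsOptimal f θ := by
  have hβ := M.beta_pos
  have hB0 : 0 ≤ B := (abs_nonneg _).trans (hB (Sum.inr true))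
  have hnn : ∀ s, 0 ≤ h s + B := fun s => by linarith [neg_abs_le (h s), hB s]
  have hη : 0 ≤ θ / M.beta := div_nonneg hθ hβ.le
  have hgm : Measurable fun s => ENNReal.ofReal (h s + B) := by fun_prop
  have hgD : ∀ s, ENNReal.ofReal (h s + B) ≤ ENNReal.ofReal (2 * B) := fun s =>
    ENNReal.ofReal_le_ofReal (by linarith [le_abs_self (h s), hB s])
  have hmul : ∀ T : ℝ, ENNReal.ofReal (θ / M.beta) * ENNReal.ofReal (M.beta * T) =
      ENNReal.ofReal (θ * T) := fun T => by
    rw [← ENNReal.ofReal_mul hη]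
    congr 1
    field_simp
  have hstep : ∀ s, ENNReal.ofReal (θ / M.beta) + ENNReal.ofReal (h s + B) =
      ENNReal.ofReal (h s + θ / M.beta + B) := fun s => by
    rw [← ENNReal.ofReal_add hη (hnn s)]
    congr 1
    ring
  -- The error `2 * B` is independent of `T`, the state and the policy, so it vanishes after
  -- division by `T`.
  have hlo : ∀ π, IsAdmissiblePolicy π → ∀ s T, 0 ≤ T → ENNReal.ofReal (θ * T) ≤
      ∫⁻ ω, M.totalCost π s ω T ∂M.law + ENNReal.ofReal (2 * B) := by
    intro π hπ s T hT
    rw [← hmul]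
    refine M.mul_time_le_lintegral_totalCost (fun k => (hπ k).1) hgm hgD ENNReal.ofReal_ne_top
      (fun k s => ?_) s hT
    rw [M.ofReal_stageCost_add_lintegral hm hB θ, hstep s]
    exact ENNReal.ofReal_le_ofReal (by linarith [hle s _ ((hπ k).2 s)])
  have hup : ∀ s T, 0 ≤ T → ∫⁻ ω, M.totalCost (fun _ => f) s ω T ∂M.law ≤
      ENNReal.ofReal (θ * T) + ENNReal.ofReal (2 * B) := by
    intro s T hT
    rw [← hmul]
    refine M.lintegral_totalCost_le_mul_time (fun k => hf) hgm hgD ENNReal.ofReal_ne_top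
      (fun k s => ?_) s hT
    rw [M.ofReal_stageCost_add_lintegral hm hB θ, hstep s, heq s]
  have hadm : IsAdmissiblePolicy fun _ => f := fun _ => ⟨hf, hfa⟩
  have hepoch : ∀ π s, M.epochAverageCost π s =ᶠ[atTop] fun T =>
      (∫⁻ ω, M.totalCost π s ω T ∂M.law) / ENNReal.ofReal (M.beta * T) := by
    intro π s
    filter_upwards [eventually_ge_atTop 0] with T hT
    rw [epochAverageCost, M.lintegral_epochCount hT]
  refine ⟨hadm, fun s => ?_, fun π hπ s => ?_, fun s => ?_, fun π hπ s => ?_,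
    h, hm, ⟨B, hB⟩, fun s => ⟨⟨f s, hfa s, heq s⟩, ?_⟩, heq⟩
  · simpa [timeAverageCost_def] using
      tendsto_div_time hθ (by positivity) (hlo _ hadm s) (hup s) one_pos
  · simpa [timeAverageCost_def] using le_liminf_div_time (by positivity) (hlo π hπ s) one_pos
  · exact (tendsto_div_time hθ (by positivity) (hlo _ hadm s) (hup s) hβ).congr'
      (hepoch _ s).symm
  · rw [liminf_congr (hepoch π s)]
    exact le_liminf_div_time (by positivity) (hlo π hπ s) hβ
  · rintro _ ⟨a, ha, rfl⟩
    exact hle s a ha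

/-! ### The explicit relative value function. -/

theorem meanShortfall_zero : M.meanShortfall 0 = 0 := by simp [meanShortfall]

theorem continuous_meanShortfall : Continuous M.meanShortfall := by
  unfold meanShortfall
  fun_prop

/-- Factor `exp (-βb)` through `exp (-βa) ≤ 1` and use the strict inequality `1 - exp (-t) < t` at
`t = β(b - a)`. -/
theorem strictMonoOn_meanShortfall : StrictMonoOn M.meanShortfall (Set.Ici 0) := by
  intro a ha b _ hab
  have hβ := M.beta_pos
  have h1 : 1 - Real.exp (-M.beta * (b - a)) < M.beta * (b - a) := by
    have : -M.beta * (b - a) ≠ 0 := by nlinarith [mul_pos hβ (sub_pos.2 hab)]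
    linarith [Real.add_one_lt_exp this]
  have h2 : Real.exp (-M.beta * a) ≤ 1 :=
    Real.exp_le_one_iff.2 (by nlinarith [mul_nonneg hβ.le (Set.mem_Ici.1 ha)])
  have h3 : Real.exp (-M.beta * b) = Real.exp (-M.beta * a) * Real.exp (-M.beta * (b - a)) := by
    rw [← Real.exp_add]
    congr 1
    ring
  have h4 : 0 ≤ 1 - Real.exp (-M.beta * (b - a)) := by
    rw [sub_nonneg, Real.exp_le_one_iff]
    nlinarith [mul_pos hβ (sub_pos.2 hab)]
  have h5 : Real.exp (-M.beta * a) - Real.exp (-M.beta * b) < M.beta * (b - a) := by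
    rw [h3]
    nlinarith
  have h6 : M.meanShortfall b - M.meanShortfall a =
      (M.beta * (b - a) - (Real.exp (-M.beta * a) - Real.exp (-M.beta * b))) / M.beta := by
    unfold meanShortfall
    field_simp
    ring
  have h7 : 0 < M.meanShortfall b - M.meanShortfall a := by
    rw [h6]
    exact div_pos (by linarith) hβ
  linarith

/-- The gain from the copy of age `τ` when it is not requested, relative to a copy of age at
least `x`, if copies are kept until age `x` and served until age `y`. -/
noncomputable def ageGain (x y τ : ℝ) : ℝ :=
  M.p * (M.ca * M.lam) * (1 - Real.exp (-M.beta * (y - x))) * max (x - τ) 0 +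
    M.p * (M.ca * M.lam) * M.beta / 2 * max (x - τ) 0 ^ 2

/-- The relative value function if copies are kept until age `x` and served until age `y`. -/
noncomputable def relativeValue (x y : ℝ) : CachingState → ℝ
  | Sum.inl (τ, true) => M.cf - M.ca * M.lam * max (y - τ) 0 - M.ageGain x y τ
      - M.p * (M.ca * M.lam) * y
  | Sum.inl (τ, false) => M.cf - M.ca * M.lam * y - M.ageGain x y τ - M.p * (M.ca * M.lam) * y
  | Sum.inr true => M.cf - M.p * (M.ca * M.lam) * y
  | Sum.inr false => M.cf - M.ca * M.lam * y - M.p * (M.ca * M.lam) * y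

/-- The expected relative value at the next epoch, if a copy of age `τ` is kept. -/
noncomputable def keepValue (x y τ : ℝ) : ℝ :=
  M.cf - M.ca * M.lam * y - M.p * (M.ca * M.lam) * M.meanShortfall (max (y - τ) 0)
    - M.p * (M.ca * M.lam) * (1 - Real.exp (-M.beta * (y - x))) * M.meanShortfall (max (x - τ) 0)
    - M.p * (M.ca * M.lam) * M.beta / 2 *
      (max (x - τ) 0 ^ 2 - 2 / M.beta * M.meanShortfall (max (x - τ) 0))

theorem continuous_ageGain (x y : ℝ) : Continuous (M.ageGain x y) := by
  unfold ageGain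
  fun_prop

theorem measurable_relativeValue (x y : ℝ) : Measurable (M.relativeValue x y) := by
  have := (M.continuous_ageGain x y).measurable
  refine measurable_fun_sum (measurable_from_prod_countable_left fun b => ?_)
    (measurable_of_countable _)
  cases b
  · change Measurable fun τ : ℝ≥0 => M.cf - M.ca * M.lam * y - M.ageGain x y τ
      - M.p * (M.ca * M.lam) * y
    fun_prop
  · change Measurable fun τ : ℝ≥0 => M.cf - M.ca * M.lam * max (y - τ) 0 - M.ageGain x y τ
      - M.p * (M.ca * M.lam) * y
    fun_prop

theorem ageGain_nonneg {x y : ℝ} (hxy : x ≤ y) (τ : ℝ) : 0 ≤ M.ageGain x y τ := by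
  have h1 := M.beta_pos
  have h2 := M.ca_pos
  have h3 := M.lam_pos
  have h4 := M.p_pos
  have h5 : 0 ≤ 1 - Real.exp (-M.beta * (y - x)) := by
    rw [sub_nonneg, Real.exp_le_one_iff]
    nlinarith
  have h6 : 0 ≤ max (x - τ) 0 := le_max_right _ _
  unfold ageGain
  positivity

theorem ageGain_of_le {x τ : ℝ} (y : ℝ) (h : x ≤ τ) : M.ageGain x y τ = 0 := by
  simp [ageGain, max_eq_right (sub_nonpos.2 h)]

theorem ageGain_anti {x y : ℝ} (hxy : x ≤ y) {τ : ℝ} (hτ : 0 ≤ τ) :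
    M.ageGain x y τ ≤ M.ageGain x y 0 := by
  have h1 := M.beta_pos
  have h2 := M.ca_pos
  have h3 := M.lam_pos
  have h4 := M.p_pos
  have h5 : 0 ≤ 1 - Real.exp (-M.beta * (y - x)) := by
    rw [sub_nonneg, Real.exp_le_one_iff]
    nlinarith
  have h6 : 0 ≤ max (x - τ) 0 := le_max_right _ _
  unfold ageGain
  gcongr

theorem exists_bound_relativeValue {x y : ℝ} (hxy : x ≤ y) :
    ∃ B, ∀ s, |M.relativeValue x y s| ≤ B := by
  have h2 := M.ca_pos
  have h3 := M.lam_pos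
  have h4 := M.cf_pos
  have h5 : 0 ≤ M.ageGain x y 0 := M.ageGain_nonneg hxy 0
  have h7 := abs_nonneg (M.ca * M.lam * y)
  refine ⟨M.cf + |M.ca * M.lam * y| + M.ageGain x y 0 + |M.p * (M.ca * M.lam) * y|, ?_⟩
  have h8 := abs_le.1 (le_refl |M.p * (M.ca * M.lam) * y|)
  have h9 := abs_le.1 (le_refl |M.ca * M.lam * y|)
  rintro (⟨τ, b⟩ | b)
  · have h10 := M.ageGain_nonneg hxy τ
    have h11 := M.ageGain_anti hxy τ.coe_nonneg
    have h12 : 0 ≤ M.ca * M.lam * max (y - τ) 0 := by positivity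
    have h13 : M.ca * M.lam * max (y - τ) 0 ≤ |M.ca * M.lam * y| := by
      rcases le_total (y - τ) 0 with h | h
      · rw [max_eq_right h, mul_zero]
        exact h7
      · rw [max_eq_left h]
        refine le_trans ?_ (le_abs_self _)
        gcongr
        linarith [τ.coe_nonneg]
    cases b <;> simp only [relativeValue] <;> refine abs_le.2 ⟨?_, ?_⟩ <;>
      linarith
  · cases b <;> simp only [relativeValue] <;> refine abs_le.2 ⟨?_, ?_⟩ <;> linarith

/-- With `θ/β = pκy`, averaging over the request indicator returns exactly `V = cf - κy`, which
makes the uncached states self-consistent. -/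
theorem integral_relativeValue_uncached {x y : ℝ} (hxy : x ≤ y) :
    ∫ w, M.relativeValue x y (Sum.inr w.2) ∂M.noise = M.cf - M.ca * M.lam * y := by
  have := isProbabilityMeasure_expMeasure M.beta_pos
  obtain ⟨B, hB⟩ := M.exists_bound_relativeValue hxy
  have hi := M.integrable_nextState (M.measurable_relativeValue x y) hB (Sum.inr false) .idle
  simp only [nextState] at hi
  rw [M.integral_noise hi]
  simp [relativeValue]
  ring

theorem integrable_shortfall (r : ℝ) :
    Integrable (fun x => max (r - x) 0) (expMeasure M.beta) := by
  have := isProbabilityMeasure_expMeasure M.beta_pos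
  refine Integrable.of_bound (by fun_prop) (max r 0) ?_
  filter_upwards [M.ae_exp_nonneg] with x hx
  rw [Real.norm_of_nonneg (le_max_right _ _)]
  exact max_le_max_right _ (by linarith)

theorem integrable_sq_shortfall (r : ℝ) :
    Integrable (fun x => max (r - x) 0 ^ 2) (expMeasure M.beta) := by
  have := isProbabilityMeasure_expMeasure M.beta_pos
  refine Integrable.of_bound (by fun_prop) (max r 0 ^ 2) ?_
  filter_upwards [M.ae_exp_nonneg] with x hx
  have h0 : 0 ≤ max (r - x) 0 := le_max_right _ _
  rw [Real.norm_of_nonneg (by positivity)]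
  gcongr
  linarith

theorem integral_relativeValue_cached {x y : ℝ} (hxy : x ≤ y) (τ : ℝ≥0) :
    ∫ w, M.relativeValue x y (Sum.inl (τ + w.1.toNNReal, w.2)) ∂M.noise = M.keepValue x y τ := by
  have := isProbabilityMeasure_expMeasure M.beta_pos
  obtain ⟨B, hB⟩ := M.exists_bound_relativeValue hxy
  have hi := M.integrable_nextState (M.measurable_relativeValue x y) hB (Sum.inl (τ, true)) .keep
  simp only [nextState] at hi
  rw [M.integral_noise hi]
  -- Conditionally on the delay, the request indicator contributes only the factor `p` on the
  -- serving gain; the age gain is the same for both values.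
  have hae : (fun t : ℝ =>
      M.p * M.relativeValue x y (Sum.inl (τ + t.toNNReal, true)) +
        (1 - M.p) * M.relativeValue x y (Sum.inl (τ + t.toNNReal, false)))
      =ᵐ[expMeasure M.beta] fun t =>
        (M.cf - M.ca * M.lam * y) - M.p * (M.ca * M.lam) * max (y - τ - t) 0
        - M.p * (M.ca * M.lam) * (1 - Real.exp (-M.beta * (y - x))) * max (x - τ - t) 0
        - M.p * (M.ca * M.lam) * M.beta / 2 * max (x - τ - t) 0 ^ 2 := by
    filter_upwards [M.ae_exp_nonneg] with t ht
    simp only [relativeValue, ageGain, NNReal.coe_add, Real.coe_toNNReal t ht, ← sub_sub]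
    ring
  have i1 := (M.integrable_shortfall (y - τ)).const_mul (M.p * (M.ca * M.lam))
  have i2 := (M.integrable_shortfall (x - τ)).const_mul
    (M.p * (M.ca * M.lam) * (1 - Real.exp (-M.beta * (y - x))))
  have i3 := (M.integrable_sq_shortfall (x - τ)).const_mul
    (M.p * (M.ca * M.lam) * M.beta / 2)
  have i0 := integrable_const (μ := expMeasure M.beta) (M.cf - M.ca * M.lam * y)
  rw [integral_congr_ae hae]
  refine (integral_sub ((i0.sub i1).sub i2) i3).trans ?_
  rw [integral_sub' (i0.sub i1) i2, integral_sub' i0 i1]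
  simp only [integral_const_mul, integral_const, probReal_univ, one_smul, M.integral_shortfall,
    M.integral_sq_shortfall, keepValue]

/-- The coefficients in `ageGain` are chosen so that the exponentials in `τ` cancel between the
shortfall to `y` and the two shortfall terms to `x`. What remains is the age gain itself plus the
constant one-step gain at age `x`. -/
theorem keepValue_of_le_left {x y τ : ℝ} (hxy : x ≤ y) (h : τ ≤ x) :
    M.keepValue x y τ = M.cf - M.ca * M.lam * y -
      M.p * (M.ca * M.lam) * M.meanShortfall (y - x) - M.ageGain x y τ := by
  have hβ := M.beta_pos
  have he : Real.exp (-M.beta * (y - τ)) =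
      Real.exp (-M.beta * (y - x)) * Real.exp (-M.beta * (x - τ)) := by
    rw [← Real.exp_add]
    congr 1
    ring
  rw [keepValue, ageGain, max_eq_left (by linarith : 0 ≤ y - τ),
    max_eq_left (by linarith : 0 ≤ x - τ)]
  unfold meanShortfall
  rw [he]
  field_simp
  ring

theorem keepValue_of_le_right {x τ : ℝ} (y : ℝ) (h : x ≤ τ) :
    M.keepValue x y τ = M.cf - M.ca * M.lam * y -
      M.p * (M.ca * M.lam) * M.meanShortfall (max (y - τ) 0) := by
  rw [keepValue, max_eq_right (by linarith : x - τ ≤ 0), meanShortfall_zero]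
  simp

/-- Up to age `x` the one-step surplus of keeping is constant; beyond `x` it decreases with age, by
monotonicity of `meanShortfall`. So a holding cost that covers the surplus at `x` covers it at every
age. -/
theorem le_keepValue {x y : ℝ} (hxy : x ≤ y)
    (hCh : M.p * (M.ca * M.lam) * M.meanShortfall (y - x) ≤ M.Ch / M.beta) (τ : ℝ) :
    M.cf - M.ca * M.lam * y - M.ageGain x y τ ≤ M.Ch / M.beta + M.keepValue x y τ := by
  rcases le_total τ x with h | h
  · rw [M.keepValue_of_le_left hxy h]
    linarith
  · rw [M.keepValue_of_le_right y h, M.ageGain_of_le y h]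
    have h1 : M.meanShortfall (max (y - τ) 0) ≤ M.meanShortfall (y - x) :=
      M.strictMonoOn_meanShortfall.monotoneOn (Set.mem_Ici.2 (le_max_right _ _))
        (Set.mem_Ici.2 (sub_nonneg.2 hxy)) (max_le (by linarith) (sub_nonneg.2 hxy))
    have h2 : 0 ≤ M.p * (M.ca * M.lam) :=
      (mul_pos M.p_pos (mul_pos M.ca_pos M.lam_pos)).le
    have h3 := mul_le_mul_of_nonneg_left h1 h2
    linarith

theorem long_run_cost_div_beta (y : ℝ) :
    M.p * M.beta * M.ca * M.lam * y / M.beta = M.p * (M.ca * M.lam) * y := by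
  have := M.beta_pos
  field_simp

/-- The value of keeping a copy of age `τ`, disregarding the present request. -/
noncomputable def holdValue (x y τ : ℝ) : ℝ := M.Ch / M.beta + M.keepValue x y τ

/-! ### Bellman's equation for two thresholds. -/

section Bellman

variable {x y : ℝ}

theorem bellmanValue_keep_true (hxy : x ≤ y) (τ : ℝ≥0) :
    M.bellmanValue (M.p * M.beta * M.ca * M.lam * y) (M.relativeValue x y) (Sum.inl (τ, true))
      .keep = M.ca * M.lam * τ + M.holdValue x y τ - M.p * (M.ca * M.lam) * y := by
  simp only [bellmanValue, stageCost, nextState, M.long_run_cost_div_beta,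
    M.integral_relativeValue_cached hxy, holdValue]
  ring

theorem bellmanValue_keep_false (hxy : x ≤ y) (τ : ℝ≥0) :
    M.bellmanValue (M.p * M.beta * M.ca * M.lam * y) (M.relativeValue x y) (Sum.inl (τ, false))
      .keep = M.holdValue x y τ - M.p * (M.ca * M.lam) * y := by
  simp only [bellmanValue, stageCost, nextState, M.long_run_cost_div_beta,
    M.integral_relativeValue_cached hxy, holdValue]
  ring

theorem bellmanValue_discard_true (hxy : x ≤ y) (τ : ℝ≥0) :
    M.bellmanValue (M.p * M.beta * M.ca * M.lam * y) (M.relativeValue x y) (Sum.inl (τ, true))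
      .discard = M.ca * M.lam * τ + (M.cf - M.ca * M.lam * y) - M.p * (M.ca * M.lam) * y := by
  simp only [bellmanValue, stageCost, nextState, M.long_run_cost_div_beta,
    M.integral_relativeValue_uncached hxy]
  ring

theorem bellmanValue_discard_false (hxy : x ≤ y) (τ : ℝ≥0) :
    M.bellmanValue (M.p * M.beta * M.ca * M.lam * y) (M.relativeValue x y) (Sum.inl (τ, false))
      .discard = M.cf - M.ca * M.lam * y - M.p * (M.ca * M.lam) * y := by
  simp only [bellmanValue, stageCost, nextState, M.long_run_cost_div_beta,
    M.integral_relativeValue_uncached hxy]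
  ring

theorem integral_relativeValue_fetched (hxy : x ≤ y) :
    ∫ w, M.relativeValue x y (Sum.inl (w.1.toNNReal, w.2)) ∂M.noise = M.keepValue x y 0 := by
  simpa using M.integral_relativeValue_cached hxy 0

theorem bellmanValue_fetchKeep_cached (hxy : x ≤ y) (τ : ℝ≥0) :
    M.bellmanValue (M.p * M.beta * M.ca * M.lam * y) (M.relativeValue x y) (Sum.inl (τ, true))
      .fetchKeep = M.cf + M.holdValue x y 0 - M.p * (M.ca * M.lam) * y := by
  simp only [bellmanValue, stageCost, nextState, M.long_run_cost_div_beta,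
    M.integral_relativeValue_fetched hxy, holdValue]
  ring

theorem bellmanValue_fetchDiscard_cached (hxy : x ≤ y) (τ : ℝ≥0) :
    M.bellmanValue (M.p * M.beta * M.ca * M.lam * y) (M.relativeValue x y) (Sum.inl (τ, true))
      .fetchDiscard =
      M.cf + (M.cf - M.ca * M.lam * y) - M.p * (M.ca * M.lam) * y := by
  simp only [bellmanValue, stageCost, nextState, M.long_run_cost_div_beta,
    M.integral_relativeValue_uncached hxy]
  ring

theorem bellmanValue_fetchKeep_uncached (hxy : x ≤ y) :
    M.bellmanValue (M.p * M.beta * M.ca * M.lam * y) (M.relativeValue x y) (Sum.inr true)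
      .fetchKeep = M.cf + M.holdValue x y 0 - M.p * (M.ca * M.lam) * y := by
  simp only [bellmanValue, stageCost, nextState, M.long_run_cost_div_beta,
    M.integral_relativeValue_fetched hxy, holdValue]
  ring

theorem bellmanValue_fetchDiscard_uncached (hxy : x ≤ y) :
    M.bellmanValue (M.p * M.beta * M.ca * M.lam * y) (M.relativeValue x y) (Sum.inr true)
      .fetchDiscard =
      M.cf + (M.cf - M.ca * M.lam * y) - M.p * (M.ca * M.lam) * y := by
  simp only [bellmanValue, stageCost, nextState, M.long_run_cost_div_beta,
    M.integral_relativeValue_uncached hxy]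
  ring

theorem bellmanValue_idle (hxy : x ≤ y) :
    M.bellmanValue (M.p * M.beta * M.ca * M.lam * y) (M.relativeValue x y) (Sum.inr false)
      .idle = M.cf - M.ca * M.lam * y - M.p * (M.ca * M.lam) * y := by
  simp only [bellmanValue, stageCost, nextState, M.long_run_cost_div_beta,
    M.integral_relativeValue_uncached hxy]
  ring

/-- A copy of age at most `x` is as valuable when kept as the relative value function says, if
the holding cost makes `x` a point of indifference. -/
theorem holdValue_of_le {τ : ℝ} (hxy : x ≤ y)
    (hCh : M.p * (M.ca * M.lam) * M.meanShortfall (y - x) = M.Ch / M.beta) (h : τ ≤ x) :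
    M.holdValue x y τ = M.cf - M.ca * M.lam * y - M.ageGain x y τ := by
  rw [holdValue, M.keepValue_of_le_left hxy h, ← hCh]
  ring

theorem relativeValue_le_bellmanValue (hxy : x ≤ y)
    (hgain : M.cf - M.ca * M.lam * y = M.ageGain x y 0)
    (hCh : M.p * (M.ca * M.lam) * M.meanShortfall (y - x) ≤ M.Ch / M.beta)
    (s : CachingState) (a : CachingAction) (ha : a ∈ availableActions s) :
    M.relativeValue x y s ≤
      M.bellmanValue (M.p * M.beta * M.ca * M.lam * y) (M.relativeValue x y) s a := by
  have hκ : 0 < M.ca * M.lam := mul_pos M.ca_pos M.lam_pos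
  -- The gain condition normalizes values: with it, holding a fresh copy is worth at least zero, so
  -- no fetch costs less than `cf`.
  have h0 : 0 ≤ M.holdValue x y 0 := by
    have := M.le_keepValue hxy hCh 0
    rw [holdValue]
    linarith
  have hV : 0 ≤ M.cf - M.ca * M.lam * y := hgain ▸ M.ageGain_nonneg hxy 0
  rcases s with ⟨τ, b⟩ | b
  · have h1 := M.ageGain_nonneg hxy τ
    have h2 : M.cf - M.ca * M.lam * y - M.ageGain x y τ ≤ M.holdValue x y τ :=
      M.le_keepValue hxy hCh τ
    have h3 : 0 ≤ M.ca * M.lam * max (y - τ) 0 := by positivity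
    have h4 : M.ca * M.lam * (y - τ) ≤ M.ca * M.lam * max (y - τ) 0 :=
      mul_le_mul_of_nonneg_left (le_max_left _ _) hκ.le
    cases b
    · rcases ha with rfl | rfl
      · rw [M.bellmanValue_keep_false hxy, relativeValue]
        linarith
      · rw [M.bellmanValue_discard_false hxy, relativeValue]
        linarith
    · rcases ha with rfl | rfl | rfl | rfl
      · rw [M.bellmanValue_keep_true hxy, relativeValue]
        linarith
      · rw [M.bellmanValue_fetchKeep_cached hxy, relativeValue]
        linarith
      · rw [M.bellmanValue_discard_true hxy, relativeValue]
        linarith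
      · rw [M.bellmanValue_fetchDiscard_cached hxy, relativeValue]
        linarith
  · cases b
    · rcases ha with rfl
      rw [M.bellmanValue_idle hxy, relativeValue]
    · rcases ha with rfl | rfl
      · rw [M.bellmanValue_fetchKeep_uncached hxy, relativeValue]
        linarith
      · rw [M.bellmanValue_fetchDiscard_uncached hxy, relativeValue]
        linarith

/-- A policy that attains the minimum in Bellman's equation for the relative value function of the
thresholds `x ≤ y` is optimal. -/
theorem isOptimal_of_thresholds (hxy : x ≤ y) (hy : 0 ≤ y)
    (hgain : M.cf - M.ca * M.lam * y = M.ageGain x y 0)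
    (hCh : M.p * (M.ca * M.lam) * M.meanShortfall (y - x) ≤ M.Ch / M.beta)
    {f : CachingState → CachingAction} (hf : Measurable f)
    (hfa : ∀ s, f s ∈ availableActions s)
    (heq : ∀ s, M.bellmanValue (M.p * M.beta * M.ca * M.lam * y) (M.relativeValue x y) s (f s) =
      M.relativeValue x y s) :
    M.IsOptimal f (M.p * M.beta * M.ca * M.lam * y) := by
  obtain ⟨B, hB⟩ := M.exists_bound_relativeValue hxy
  have h1 := M.beta_pos
  have h2 := M.ca_pos
  have h3 := M.lam_pos
  have h4 := M.p_pos
  exact M.isOptimal_of_bellman (by positivity) hf hfa (M.measurable_relativeValue x y) hB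
    (M.relativeValue_le_bellmanValue hxy hgain hCh) heq

end Bellman

end CachingModel

/-! ### Measurability and admissibility of the three policies. -/

theorem measurableSet_coe_le (r : ℝ) : MeasurableSet {τ : ℝ≥0 | (τ : ℝ) ≤ r} :=
  measurableSet_le (by fun_prop) measurable_const

theorem measurable_cachingRule {f : CachingState → CachingAction}
    (h : ∀ b, Measurable fun τ : ℝ≥0 => f (Sum.inl (τ, b))) : Measurable f :=
  measurable_fun_sum (measurable_from_prod_countable_left h) (measurable_of_countable _)

theorem measurable_alwaysCachePolicy (r : ℝ) : Measurable (alwaysCachePolicy r) := by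
  refine measurable_cachingRule fun b => ?_
  cases b <;> simp only [alwaysCachePolicy]
  · exact measurable_const
  · exact Measurable.ite (measurableSet_coe_le r) measurable_const measurable_const

theorem measurable_neverCachePolicy (r : ℝ) : Measurable (neverCachePolicy r) := by
  refine measurable_cachingRule fun b => ?_
  cases b <;> simp only [neverCachePolicy]
  · exact measurable_const
  · exact Measurable.ite (measurableSet_coe_le r) measurable_const measurable_const

theorem measurable_twoThresholdPolicy (tie : CachingAction) (x y : ℝ) :
    Measurable (twoThresholdPolicy tie x y) := by
  refine measurable_cachingRule fun b => ?_
  cases b <;> simp only [twoThresholdPolicy]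
  · exact Measurable.ite (measurableSet_coe_le x) measurable_const measurable_const
  · refine Measurable.ite (measurableSet_lt (by fun_prop) measurable_const) measurable_const
      (Measurable.ite (measurableSet_eq_fun (by fun_prop) measurable_const) measurable_const
        (Measurable.ite (measurableSet_coe_le y) measurable_const measurable_const))

theorem alwaysCachePolicy_mem (r : ℝ) (s : CachingState) :
    alwaysCachePolicy r s ∈ availableActions s := by
  rcases s with ⟨τ, b⟩ | b <;> cases b <;> simp only [alwaysCachePolicy, availableActions] <;>
    try split_ifs
  all_goals simp

theorem neverCachePolicy_mem (r : ℝ) (s : CachingState) :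
    neverCachePolicy r s ∈ availableActions s := by
  rcases s with ⟨τ, b⟩ | b <;> cases b <;> simp only [neverCachePolicy, availableActions] <;>
    try split_ifs
  all_goals simp

theorem twoThresholdPolicy_mem {tie : CachingAction} (ht : tie = .keep ∨ tie = .discard) (x y : ℝ)
    (s : CachingState) : twoThresholdPolicy tie x y s ∈ availableActions s := by
  rcases s with ⟨τ, b⟩ | b <;> cases b <;> simp only [twoThresholdPolicy, availableActions] <;>
    try split_ifs
  all_goals rcases ht with rfl | rfl <;> simp

/-! ### The threshold equations. -/

namespace CachingModel

variable (M : CachingModel)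

theorem tauStar_nonneg : 0 ≤ M.tauStar := by
  have h1 := M.beta_pos
  have h2 := M.ca_pos
  have h3 := M.lam_pos
  have h4 := M.p_pos
  have h5 := M.cf_pos
  have h6 : 1 / (M.p * M.beta) ≤
      √((1 / (M.p * M.beta)) ^ 2 + 2 * M.cf / (M.p * M.beta * M.ca * M.lam)) := by
    refine Real.le_sqrt_of_sq_le ?_
    have : 0 ≤ 2 * M.cf / (M.p * M.beta * M.ca * M.lam) := by positivity
    linarith
  unfold tauStar
  linarith

theorem tauStar_equation :
    M.ca * M.lam * M.p * M.beta * M.tauStar ^ 2 / 2 + M.ca * M.lam * M.tauStar = M.cf := by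
  have h1 := M.beta_pos
  have h2 := M.ca_pos
  have h3 := M.lam_pos
  have h4 := M.p_pos
  have h5 := M.cf_pos
  have hs := Real.sq_sqrt (show 0 ≤ (1 / (M.p * M.beta)) ^ 2 +
    2 * M.cf / (M.p * M.beta * M.ca * M.lam) by positivity)
  have ht : M.tauStar + 1 / (M.p * M.beta) =
    √((1 / (M.p * M.beta)) ^ 2 + 2 * M.cf / (M.p * M.beta * M.ca * M.lam)) := by
    unfold tauStar
    ring
  rw [← ht] at hs
  have hq : M.tauStar ^ 2 + 2 * M.tauStar / (M.p * M.beta) =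
      2 * M.cf / (M.p * M.beta * M.ca * M.lam) := by linear_combination hs
  field_simp at hq
  linear_combination hq / 2

theorem tauZero_pos : 0 < M.tauZero := div_pos M.cf_pos (mul_pos M.ca_pos M.lam_pos)

theorem cf_eq_mul_tauZero : M.cf = M.ca * M.lam * M.tauZero := by
  have h2 := M.ca_pos
  have h3 := M.lam_pos
  unfold tauZero
  field_simp

/-- Divided by `β`, the critical holding cost is the expected one-step gain from keeping a fresh
copy that would be served up to age `tauZero`. -/
theorem holdingThreshold_eq :
    M.holdingThreshold = M.p * (M.ca * M.lam) * M.beta * M.meanShortfall M.tauZero := by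
  have h1 := M.beta_pos
  have h2 := M.ca_pos
  have h3 := M.lam_pos
  unfold holdingThreshold meanShortfall
  rw [M.cf_eq_mul_tauZero]
  field_simp

/-- The second threshold equation says that keeping and discarding are equally good at age `x`. -/
theorem second_equation_iff (x y : ℝ) :
    M.beta * (y - x) + Real.exp (-M.beta * (y - x)) - 1 - M.Ch / (M.p * M.ca * M.lam) = 0 ↔
      M.p * (M.ca * M.lam) * M.meanShortfall (y - x) = M.Ch / M.beta := by
  have h1 := M.beta_pos
  have h2 := M.ca_pos
  have h3 := M.lam_pos
  have h4 := M.p_pos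
  unfold meanShortfall
  field_simp
  constructor <;> intro h <;> linear_combination h

/-- Eliminating `Ch` from the first equation by means of the second leaves the quadratic polynomial
`ageGain x y 0` in `x`. -/
theorem gain_of_thresholdEquations {x y : ℝ} (hx : 0 ≤ x) (h : M.ThresholdEquations x y) :
    M.cf - M.ca * M.lam * y = M.ageGain x y 0 := by
  have h1 := M.beta_pos
  have h2 := M.ca_pos
  have h3 := M.lam_pos
  have h4 := M.p_pos
  obtain ⟨e1, e2⟩ := h
  have e3 : M.Ch =
      M.p * M.ca * M.lam * (M.beta * (y - x) + Real.exp (-M.beta * (y - x)) - 1) := by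
    rw [sub_eq_zero, eq_div_iff (by positivity)] at e2
    linear_combination -e2
  rw [ageGain, sub_zero, max_eq_left hx]
  rw [e3] at e1
  linear_combination -e1

/-- The first threshold equation in terms of `x` and the difference `d = y - x`. -/
noncomputable def thresholdDefect (d x : ℝ) : ℝ :=
  M.ca * M.lam * M.p * M.beta * (x ^ 2 / 2 + d * x) - M.Ch * x + M.ca * M.lam * (x + d) - M.cf

theorem thresholdEquations_iff (x y : ℝ) :
    M.ThresholdEquations x y ↔ M.thresholdDefect (y - x) x = 0 ∧
      M.p * (M.ca * M.lam) * M.meanShortfall (y - x) = M.Ch / M.beta := by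
  unfold ThresholdEquations
  rw [M.second_equation_iff]
  refine and_congr_left fun _ => ?_
  unfold thresholdDefect
  constructor <;> intro h <;> linear_combination h

/-- Since `meanShortfall d ≤ d`, the linear coefficient `κpβd - Ch` in `thresholdDefect d` is
nonnegative, which yields its monotonicity and signs. -/
theorem Ch_le_of_meanShortfall {d : ℝ} (hd : 0 ≤ d)
    (h : M.p * (M.ca * M.lam) * M.meanShortfall d = M.Ch / M.beta) :
    M.Ch ≤ M.ca * M.lam * M.p * M.beta * d := by
  have h1 := M.beta_pos
  have h2 := M.ca_pos
  have h3 := M.lam_pos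
  have h4 := M.p_pos
  have h5 : Real.exp (-M.beta * d) ≤ 1 := Real.exp_le_one_iff.2 (by nlinarith)
  have h6 : M.meanShortfall d ≤ d := by
    have : 0 ≤ (1 - Real.exp (-M.beta * d)) / M.beta := div_nonneg (by linarith) h1.le
    unfold meanShortfall
    linarith
  rw [eq_div_iff h1.ne'] at h
  rw [← h]
  have : M.p * (M.ca * M.lam) * M.meanShortfall d * M.beta ≤
      M.p * (M.ca * M.lam) * d * M.beta := by gcongr
  linarith

theorem strictMonoOn_thresholdDefect {d : ℝ} (hd : M.Ch ≤ M.ca * M.lam * M.p * M.beta * d) :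
    StrictMonoOn (M.thresholdDefect d) (Set.Ici 0) := by
  intro a ha b _ hab
  have hκ : 0 < M.ca * M.lam := mul_pos M.ca_pos M.lam_pos
  have hk : 0 < M.ca * M.lam * M.p * M.beta := mul_pos (mul_pos hκ M.p_pos) M.beta_pos
  have h1 : 0 ≤ (M.ca * M.lam * M.p * M.beta * d - M.Ch) * (b - a) :=
    mul_nonneg (by linarith) (by linarith)
  have h2 : 0 < M.ca * M.lam * (b - a) := mul_pos hκ (by linarith)
  have ha' : 0 ≤ a := ha
  have h3 : 0 ≤ M.ca * M.lam * M.p * M.beta * ((b - a) * (b + a)) :=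
    mul_nonneg hk.le (mul_nonneg (by linarith) (by linarith))
  unfold thresholdDefect
  linarith

/-- Intermediate values between `0` and `tauZero`: the condition on `Ch` says precisely that the
target does not exceed the value at `tauZero`. -/
theorem exists_meanShortfall_eq (h : M.Ch ≤ M.holdingThreshold) :
    ∃ d, 0 ≤ d ∧ d ≤ M.tauZero ∧
      M.p * (M.ca * M.lam) * M.meanShortfall d = M.Ch / M.beta := by
  have hβ := M.beta_pos
  have hk : 0 < M.p * (M.ca * M.lam) := mul_pos M.p_pos (mul_pos M.ca_pos M.lam_pos)
  have hc : ContinuousOn M.meanShortfall (Set.Icc 0 M.tauZero) :=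
    M.continuous_meanShortfall.continuousOn
  obtain ⟨d, hd, hd'⟩ := intermediate_value_Icc M.tauZero_pos.le hc
    (show M.Ch / M.beta / (M.p * (M.ca * M.lam)) ∈ _ by
      rw [meanShortfall_zero]
      refine ⟨by have := M.Ch_nonneg; positivity, ?_⟩
      rw [holdingThreshold_eq] at h
      rw [div_le_iff₀ hk, div_le_iff₀ hβ]
      linarith)
  exact ⟨d, hd.1, hd.2, by rw [hd', mul_div_cancel₀ _ hk.ne']⟩

theorem exists_thresholds (h : M.Ch ≤ M.holdingThreshold) :
    ∃ x y, 0 ≤ x ∧ x ≤ y ∧ M.ThresholdEquations x y := by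
  obtain ⟨d, hd0, hd1, hd⟩ := M.exists_meanShortfall_eq h
  have hκ : 0 < M.ca * M.lam := mul_pos M.ca_pos M.lam_pos
  have hCh := M.Ch_le_of_meanShortfall hd0 hd
  have hc : ContinuousOn (M.thresholdDefect d) (Set.Icc 0 M.tauStar) := by
    unfold thresholdDefect
    fun_prop
  -- At `x = 0` the defect is `κd - cf ≤ 0`; at `tauStar` the quadratic part already equals `cf` and
  -- the other terms are nonnegative.
  obtain ⟨x, hx, hx'⟩ := intermediate_value_Icc M.tauStar_nonneg hc (show (0 : ℝ) ∈ _ by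
    constructor
    · have := mul_le_mul_of_nonneg_left hd1 hκ.le
      rw [← M.cf_eq_mul_tauZero] at this
      unfold thresholdDefect
      linarith
    · have h1 := M.tauStar_equation
      have h2 : 0 ≤ (M.ca * M.lam * M.p * M.beta * d - M.Ch) * M.tauStar :=
        mul_nonneg (by linarith) M.tauStar_nonneg
      have h3 : 0 ≤ M.ca * M.lam * d := mul_nonneg hκ.le hd0
      unfold thresholdDefect
      linarith)
  refine ⟨x, x + d, hx.1, by linarith, (M.thresholdEquations_iff _ _).2 ?_⟩
  rw [add_sub_cancel_left]
  exact ⟨hx', hd⟩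

theorem thresholds_unique {x y x' y' : ℝ} (hx : 0 ≤ x) (hxy : x ≤ y)
    (h : M.ThresholdEquations x y) (hx' : 0 ≤ x') (hxy' : x' ≤ y')
    (h' : M.ThresholdEquations x' y') : x' = x ∧ y' = y := by
  have hk : 0 < M.p * (M.ca * M.lam) := mul_pos M.p_pos (mul_pos M.ca_pos M.lam_pos)
  obtain ⟨e1, e2⟩ := (M.thresholdEquations_iff _ _).1 h
  obtain ⟨e1', e2'⟩ := (M.thresholdEquations_iff _ _).1 h'
  have hd : y' - x' = y - x :=
    M.strictMonoOn_meanShortfall.injOn (sub_nonneg.2 hxy') (sub_nonneg.2 hxy)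
      (mul_left_cancel₀ hk.ne' (e2'.trans e2.symm))
  rw [hd] at e1'
  have hxx : x' = x :=
    (M.strictMonoOn_thresholdDefect (M.Ch_le_of_meanShortfall (sub_nonneg.2 hxy) e2)).injOn
      hx' hx (e1'.trans e1.symm)
  exact ⟨hxx, by linarith⟩

theorem strictMonoOn_quadratic :
    StrictMonoOn (fun t : ℝ => M.ca * M.lam * M.p * M.beta * t ^ 2 / 2 + M.ca * M.lam * t)
      (Set.Ici 0) := by
  intro a ha b _ hab
  have hκ : 0 < M.ca * M.lam := mul_pos M.ca_pos M.lam_pos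
  have hk : 0 < M.ca * M.lam * M.p * M.beta := mul_pos (mul_pos hκ M.p_pos) M.beta_pos
  have ha' : 0 ≤ a := ha
  have h2 : 0 < M.ca * M.lam * (b - a) := mul_pos hκ (by linarith)
  have h3 : 0 ≤ M.ca * M.lam * M.p * M.beta * ((b - a) * (b + a)) :=
    mul_nonneg hk.le (mul_nonneg (by linarith) (by linarith))
  dsimp only
  linarith

/-- Compare values of the increasing quadratic `κpβt²/2 + κt`, which equals `cf` at `tauStar`. With
`d = y - x > 0`, its value at `x` is below `cf` by at least `κd`, and its value at `y` exceeds `cf`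
by `κpβd²/2 + Ch * x`. -/
theorem thresholds_bounds (hpos : 0 < M.Ch) {x y : ℝ} (hx : 0 ≤ x) (hxy : x ≤ y)
    (h : M.ThresholdEquations x y) :
    x < M.tauStar ∧ M.tauStar < y ∧ y ≤ M.tauZero := by
  have hκ : 0 < M.ca * M.lam := mul_pos M.ca_pos M.lam_pos
  have hk : 0 < M.ca * M.lam * M.p * M.beta := mul_pos (mul_pos hκ M.p_pos) M.beta_pos
  obtain ⟨e1, e2⟩ := (M.thresholdEquations_iff _ _).1 h
  have hCh := M.Ch_le_of_meanShortfall (sub_nonneg.2 hxy) e2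
  have hd : 0 < y - x := by
    by_contra hneg
    have : y - x = 0 := le_antisymm (not_lt.1 hneg) (sub_nonneg.2 hxy)
    rw [this, mul_zero] at hCh
    linarith
  have hs := M.tauStar_equation
  have hmono := M.strictMonoOn_quadratic
  unfold thresholdDefect at e1
  have h1 : 0 ≤ (M.ca * M.lam * M.p * M.beta * (y - x) - M.Ch) * x :=
    mul_nonneg (by linarith) hx
  have h2 : 0 < M.ca * M.lam * (y - x) := mul_pos hκ hd
  have h3 : 0 < M.ca * M.lam * M.p * M.beta * (y - x) ^ 2 := by positivity
  have h4 : 0 ≤ M.Ch * x := by positivity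
  have h5 : 0 ≤ M.ca * M.lam * M.p * M.beta * x ^ 2 := by positivity
  refine ⟨?_, ?_, ?_⟩
  · refine (hmono.lt_iff_lt hx M.tauStar_nonneg).1 ?_
    linarith
  · refine (hmono.lt_iff_lt M.tauStar_nonneg (hx.trans hxy)).1 ?_
    linarith
  · refine le_of_mul_le_mul_left ?_ hκ
    rw [← M.cf_eq_mul_tauZero]
    linarith

/-! ### Optimality in the three regimes. -/

theorem isOptimal_alwaysCachePolicy (hCh : M.Ch = 0) :
    M.IsOptimal (alwaysCachePolicy M.tauStar) (M.p * M.beta * M.ca * M.lam * M.tauStar) := by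
  have hindiff : M.p * (M.ca * M.lam) * M.meanShortfall (M.tauStar - M.tauStar) =
      M.Ch / M.beta := by simp [hCh, meanShortfall_zero]
  have heqs : M.ThresholdEquations M.tauStar M.tauStar := by
    refine (M.thresholdEquations_iff _ _).2 ⟨?_, hindiff⟩
    have := M.tauStar_equation
    unfold thresholdDefect
    rw [hCh]
    linarith
  have hgain := M.gain_of_thresholdEquations M.tauStar_nonneg heqs
  -- Without a holding cost, keeping is as good as discarding even beyond the threshold, so the
  -- formula holds at every age and an unrequested copy may always be kept.
  have hhold : ∀ τ, M.holdValue M.tauStar M.tauStar τ =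
      M.cf - M.ca * M.lam * M.tauStar - M.ageGain M.tauStar M.tauStar τ := by
    intro τ
    rcases le_total τ M.tauStar with h | h
    · exact M.holdValue_of_le le_rfl hindiff h
    · rw [holdValue, M.keepValue_of_le_right _ h, M.ageGain_of_le _ h,
        max_eq_right (sub_nonpos.2 h), hCh, meanShortfall_zero]
      ring
  refine M.isOptimal_of_thresholds le_rfl M.tauStar_nonneg hgain hindiff.le
    (measurable_alwaysCachePolicy _) (alwaysCachePolicy_mem _) ?_
  rintro (⟨τ, _ | _⟩ | _ | _) <;> simp only [alwaysCachePolicy]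
  · rw [M.bellmanValue_keep_false le_rfl, relativeValue, hhold]
  · split_ifs with h
    · rw [M.bellmanValue_keep_true le_rfl, relativeValue, hhold, max_eq_left (by linarith)]
      ring
    · rw [not_le] at h
      rw [M.bellmanValue_fetchKeep_cached le_rfl, relativeValue, hhold, ← hgain,
        M.ageGain_of_le _ h.le, max_eq_right (by linarith)]
      ring
  · rw [M.bellmanValue_idle le_rfl, relativeValue]
  · rw [M.bellmanValue_fetchKeep_uncached le_rfl, relativeValue, hhold, ← hgain]
    ring

theorem isOptimal_twoThresholdPolicy {x y : ℝ} (hx : 0 ≤ x) (hxy : x ≤ y)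
    (heqs : M.ThresholdEquations x y) {tie : CachingAction}
    (ht : tie = .keep ∨ tie = .discard) :
    M.IsOptimal (twoThresholdPolicy tie x y) (M.p * M.beta * M.ca * M.lam * y) := by
  have hindiff := ((M.thresholdEquations_iff _ _).1 heqs).2
  have hgain := M.gain_of_thresholdEquations hx heqs
  -- Holding a fresh copy has value zero, so fetching and keeping costs exactly `cf` before
  -- subtracting `θ/β`.
  have hzero : M.holdValue x y 0 = 0 := by
    rw [M.holdValue_of_le hxy hindiff hx, hgain, sub_self]
  have hkeep : ∀ τ : ℝ≥0, (τ : ℝ) ≤ x →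
      M.bellmanValue (M.p * M.beta * M.ca * M.lam * y) (M.relativeValue x y) (Sum.inl (τ, true))
        .keep = M.relativeValue x y (Sum.inl (τ, true)) := by
    intro τ h
    rw [M.bellmanValue_keep_true hxy, relativeValue, M.holdValue_of_le hxy hindiff h,
      max_eq_left (by linarith)]
    ring
  have hdiscard : ∀ τ : ℝ≥0, x ≤ τ → (τ : ℝ) ≤ y →
      M.bellmanValue (M.p * M.beta * M.ca * M.lam * y) (M.relativeValue x y) (Sum.inl (τ, true))
        .discard = M.relativeValue x y (Sum.inl (τ, true)) := by
    intro τ h h'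
    rw [M.bellmanValue_discard_true hxy, relativeValue, M.ageGain_of_le _ h,
      max_eq_left (by linarith)]
    ring
  refine M.isOptimal_of_thresholds hxy (hx.trans hxy) hgain hindiff.le
    (measurable_twoThresholdPolicy _ _ _) (twoThresholdPolicy_mem ht _ _) ?_
  rintro (⟨τ, _ | _⟩ | _ | _) <;> simp only [twoThresholdPolicy]
  · split_ifs with h
    · rw [M.bellmanValue_keep_false hxy, relativeValue, M.holdValue_of_le hxy hindiff h]
    · rw [M.bellmanValue_discard_false hxy, relativeValue, M.ageGain_of_le _ (not_le.1 h).le]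
      ring
  · split_ifs with h1 h2 h3
    · exact hkeep τ h1.le
    · rcases ht with rfl | rfl
      · exact hkeep τ h2.le
      · exact hdiscard τ h2.ge (h2.le.trans hxy)
    · exact hdiscard τ (not_lt.1 h1) h3
    · rw [not_le] at h3
      rw [M.bellmanValue_fetchKeep_cached hxy, relativeValue, hzero,
        M.ageGain_of_le _ (not_lt.1 h1), max_eq_right (by linarith)]
      ring
  · rw [M.bellmanValue_idle hxy, relativeValue]
  · rw [M.bellmanValue_fetchKeep_uncached hxy, relativeValue, hzero]
    ring

/-- Here `x = 0` and `y = tauZero`, so the age gain vanishes at every age and an empty cache has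
value zero. Only the inequality for the holding cost is needed, because the policy never keeps a
copy. -/
theorem isOptimal_neverCachePolicy (h : M.holdingThreshold ≤ M.Ch) :
    M.IsOptimal (neverCachePolicy M.tauZero) (M.p * M.beta * M.cf) := by
  have hxy := M.tauZero_pos.le
  have hcost : M.p * M.beta * M.cf = M.p * M.beta * M.ca * M.lam * M.tauZero := by
    rw [M.cf_eq_mul_tauZero]
    ring
  have hgain : M.cf - M.ca * M.lam * M.tauZero = M.ageGain 0 M.tauZero 0 := by
    rw [M.ageGain_of_le _ le_rfl, ← M.cf_eq_mul_tauZero, sub_self]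
  have hCh : M.p * (M.ca * M.lam) * M.meanShortfall (M.tauZero - 0) ≤ M.Ch / M.beta := by
    rw [sub_zero, le_div_iff₀ M.beta_pos]
    rw [holdingThreshold_eq] at h
    linarith
  have hz := M.cf_eq_mul_tauZero
  rw [hcost]
  refine M.isOptimal_of_thresholds hxy hxy hgain hCh
    (measurable_neverCachePolicy _) (neverCachePolicy_mem _) ?_
  rintro (⟨τ, _ | _⟩ | _ | _) <;> simp only [neverCachePolicy]
  · rw [M.bellmanValue_discard_false hxy, relativeValue, M.ageGain_of_le _ τ.coe_nonneg]
    ring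
  · split_ifs with h
    · rw [M.bellmanValue_discard_true hxy, relativeValue, M.ageGain_of_le _ τ.coe_nonneg,
        max_eq_left (by linarith)]
      ring
    · rw [not_le] at h
      rw [M.bellmanValue_fetchDiscard_cached hxy, relativeValue, M.ageGain_of_le _ τ.coe_nonneg,
        max_eq_right (by linarith)]
      linarith
  · rw [M.bellmanValue_idle hxy, relativeValue]
  · rw [M.bellmanValue_fetchDiscard_uncached hxy, relativeValue]
    linarith

end CachingModel

theorem theorem1 (M : CachingModel) :
    (M.Ch = 0 →
      M.IsOptimal (alwaysCachePolicy M.tauStar) (M.p * M.beta * M.ca * M.lam * M.tauStar)) ∧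
    (0 < M.Ch → M.Ch ≤ M.holdingThreshold →
      ∃ τbar τtil : ℝ,
        (0 ≤ τbar ∧ τbar ≤ τtil ∧ M.ThresholdEquations τbar τtil) ∧
        (∀ x y : ℝ, 0 ≤ x → x ≤ y → M.ThresholdEquations x y → x = τbar ∧ y = τtil) ∧
        0 ≤ τbar ∧ τbar < M.tauStar ∧ M.tauStar < τtil ∧ τtil ≤ M.tauZero ∧
        (M.Ch < M.holdingThreshold →
          ∀ tie : CachingAction, tie = .keep ∨ tie = .discard →
            M.IsOptimal (twoThresholdPolicy tie τbar τtil)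
              (M.p * M.beta * M.ca * M.lam * τtil))) ∧
    (M.holdingThreshold < M.Ch →
      M.IsOptimal (neverCachePolicy M.tauZero) (M.p * M.beta * M.cf)) := by
  refine ⟨M.isOptimal_alwaysCachePolicy, fun hpos hle => ?_,
    fun h => M.isOptimal_neverCachePolicy h.le⟩
  obtain ⟨x, y, hx, hxy, heqs⟩ := M.exists_thresholds hle
  obtain ⟨h1, h2, h3⟩ := M.thresholds_bounds hpos hx hxy heqs
  exact ⟨x, y, ⟨hx, hxy, heqs⟩,
    fun x' y' hx' hxy' h' => M.thresholds_unique hx hxy heqs hx' hxy' h', hx, h1, h2, h3,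
    fun _ tie ht => M.isOptimal_twoThresholdPolicy hx hxy heqs ht⟩
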